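/- Let $n\ge 0$ be an integer and $k\le -1$ a real number, write points of $\mathbb{R}^{n+1}=\mathbb{R}^n\times\mathbb{R}$ as $(x,\rho)$ and covectors as $(\xi,\eta)$, and let $A$ be the pseudodifferential operator $$Au(x,\rho)=\frac{1}{(2\pi)^{n+1}}\int a(x,\rho,\xi,\eta)\,\widehat u(\xi,\eta)\,e^{i(x\cdot\xi+\rho\eta)}\,d\xi\,d\eta ,\qquad \widehat u(\xi,\eta)=\int u(x,\rho)\,e^{-i(x\cdot\xi+\rho\eta)}\,dx\,d\rho,$$ (extended to tempered distributions $u$ by duality) with symbol $a\in\mathcal S^{k}(\mathbb{R}^{n+1}\times\mathbb{R}^{n+1})$. Here $p\in\mathcal S^m(X\times\Xi)$ means that $p$ is smooth and that for every compact $K\subset X$ and all multi-indices $\alpha,\beta$ there is $C$ with $|\partial_z^\alpha\partial_\zeta^\beta p(z,\zeta)|\le C(1+|\zeta|)^{m-|\beta|}$ for $z\in K$, $\zeta\in\Xi$. Assume that $a$ is meromorphic in $\eta$ in the following sense: there are finitely many functions $q_1,\dots,q_N\in\mathcal S^1(\mathbb{R}^{n+1}\times\mathbb{R}^n)$ of $(x,\rho,\xi)$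 such that for each $(x,\rho,\xi)$ the function $\eta\mapsto a(x,\rho,\xi,\eta)$ extends from $\mathbb{R}$ to a meromorphic function on $\mathbb{C}$ whose poles, counted with multiplicity, are among $q_1(x,\rho,\xi),\dots,q_N(x,\rho,\xi)$, and which is $O(|\eta|^M)$ as $|\eta|\to\infty$ in the closed lower half-plane $\operatorname{Im}\eta\le 0$, for some $M$ that may depend on $(x,\rho,\xi)$. Assume further that * for each $i$ and each $\rho$ the residue $\operatorname{Res}_{\eta=q_i}a$, as a function of $(x,\xi)$, belongs to $\mathcal S^{k+1}(\mathbb{R}^n\times\mathbb{R}^n)$, with symbol estimates uniform for $\rho$ in compact sets; * each $\operatorname{Im}q_i$ is elliptic of order $1$: for every compact $K\subset\mathbb{R}^{n+1}$ there are $c>0$ and $R$ with $|\operatorname{Im}q_i(x,\rho,\xi)|\ge c|\xi|$ for $(x,\rho)\in K$, $|\xi|\ge R$. Then for every $s\ge 0$ and every $\chi\in C_c^\infty(\mathbb{R}^{n+1})$ there is a constant $C$ such that for all $g_b\in W^{s+k+1/2}(\mathbb{R}^n)$ the distribution $g(x,\rho)=g_b(x)\,\delta(\rho)$ satisfies $$\|\chi\,Ag\|_{W^s(\mathbb{H}^{n+1}_-)}\le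 C\,\|g_b\|_{W^{s+k+1/2}(\mathbb{R}^n)},$$ where $\mathbb{H}^{n+1}_-=\{\rho<0\}$ and $\|T\|_{W^s(\mathbb{H}^{n+1}_-)}$ is the infimum of $\|F\|_{W^s(\mathbb{R}^{n+1})}$ over all $F\in W^s(\mathbb{R}^{n+1})$ that coincide with $T$ on $\mathbb{H}^{n+1}_-$ (in particular such $F$ exist for $T=\chi Ag$). That is, $\|Ag\|_{W^s_{loc}(\mathbb{H}^{n+1}_-)}\lesssim\|g_b\|_{W^{s+k+1/2}(\mathbb{R}^n)}$, locally up to the boundary $\rho=0$. -/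

import Mathlib

open MeasureTheory Filter Topology SchwartzMap FourierTransform TemperedDistribution
open scoped ENNReal NNReal ContDiff

noncomputable section

namespace PsiDO

/-- The space `ℝⁿ` of the tangential variables `x`, and of their dual variables `ξ`. -/
abbrev Tang (n : ℕ) : Type := EuclideanSpace ℝ (Fin n)

/-- The space `ℝⁿ⁺¹ = ℝⁿ × ℝ` with its Euclidean norm and Lebesgue measure; its points are
written `z = (x, ρ)`, those of the dual space `(ξ, η)`. -/
abbrev Amb (n : ℕ) : Type := WithLp 2 (Tang n × ℝ)

/-- The point `(x, ρ)` (or the covector `(ξ, η)`) of `ℝⁿ⁺¹`. -/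
abbrev pt {n : ℕ} (x : Tang n) (ρ : ℝ) : Amb n := WithLp.toLp 2 (x, ρ)

/-! ### Symbols -/

/-- The symbol class `S^m(X × Ξ)`: smooth functions `p(z, ξ)` such that for every compact
`K ⊆ X` and all orders `i`, `j` one has
`|∂_ξ^j ∂_z^i p(z, ξ)| ≤ C (1 + |ξ|)^(m - j)` for `z ∈ K` and all `ξ`. -/
def IsSymbol {X Ξ : Type} [NormedAddCommGroup X] [NormedSpace ℝ X]
    [NormedAddCommGroup Ξ] [NormedSpace ℝ Ξ] (m : ℝ) (p : X → Ξ → ℂ) : Prop :=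
  ContDiff ℝ ∞ (fun w : X × Ξ => p w.1 w.2) ∧
    ∀ K : Set X, IsCompact K → ∀ i j : ℕ, ∃ C : ℝ, ∀ z ∈ K, ∀ ξ : Ξ,
      ‖iteratedFDeriv ℝ j (fun ξ' => iteratedFDeriv ℝ i (fun z' => p z' ξ') z) ξ‖
        ≤ C * (1 + ‖ξ‖) ^ (m - j)

/-- For each `ρ` the function `(x, ξ) ↦ p((x, ρ), ξ)` is a symbol in `S^m(ℝⁿ × ℝⁿ)`, with symbol
estimates that are uniform for `ρ` in compact sets; nothing is assumed on `ρ`-derivatives. -/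
def IsTangentialSymbol {n : ℕ} (m : ℝ) (p : Amb n → Tang n → ℂ) : Prop :=
  (∀ ρ : ℝ, ContDiff ℝ ∞ (fun w : Tang n × Tang n => p (pt w.1 ρ) w.2)) ∧
    ∀ K : Set (Amb n), IsCompact K → ∀ i j : ℕ, ∃ C : ℝ, ∀ z ∈ K, ∀ ξ : Tang n,
      ‖iteratedFDeriv ℝ j
          (fun ξ' => iteratedFDeriv ℝ i (fun x' => p (pt x' z.snd) ξ') z.fst) ξ‖
        ≤ C * (1 + ‖ξ‖) ^ (m - j)

/-- Ellipticity of order `1`: locally uniformly in `z`, `|p(z, ξ)| ≥ c |ξ|` for large `|ξ|`. -/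
def IsEllipticOne {n : ℕ} (p : Amb n → Tang n → ℝ) : Prop :=
  ∀ K : Set (Amb n), IsCompact K → ∃ c > 0, ∃ R : ℝ, ∀ z ∈ K, ∀ ξ : Tang n,
    R ≤ ‖ξ‖ → c * ‖ξ‖ ≤ |p z ξ|

/-! ### Meromorphy in the normal covariable -/

/-- `f` is holomorphic in a punctured neighbourhood of `c` (in all uses below) and `r` is its
residue at `c`: `∮ f = 2πi r` over all small circles around `c`. -/
def HasResidueAt (f : ℂ → ℂ) (c r : ℂ) : Prop :=
  ∀ᶠ ε in 𝓝[>] (0 : ℝ), (∮ ζ in C(c, ε), f ζ) = 2 * Real.pi * Complex.I * r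

/-- For each `(z, ξ)` the function `aExt z ξ` is a meromorphic function on `ℂ` that extends
`η ↦ a(z, ξ, η)`, its poles, counted with multiplicity, are among
`q 0 (z, ξ), …, q (N - 1) (z, ξ)`, and it grows at most polynomially at infinity in the closed
lower half-plane. -/
structure IsMeromorphicExtension {n N : ℕ} (a : Amb n → Amb n → ℂ)
    (q : Fin N → Amb n → Tang n → ℂ) (aExt : Amb n → Tang n → ℂ → ℂ) : Prop where
  extends_symbol : ∀ z ξ (η : ℝ), aExt z ξ (η : ℂ) = a z (pt ξ η)
  meromorphic : ∀ z ξ ζ, MeromorphicAt (aExt z ξ) ζ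
  analytic : ∀ z ξ ζ, (∀ i, q i z ξ ≠ ζ) → AnalyticAt ℂ (aExt z ξ) ζ
  pole_order : ∀ z ξ ζ,
    ((-(Nat.card {i : Fin N // q i z ξ = ζ} : ℤ) : ℤ) : WithTop ℤ)
      ≤ meromorphicOrderAt (aExt z ξ) ζ
  growth : ∀ z ξ, ∃ M : ℕ,
    aExt z ξ =O[Bornology.cobounded ℂ ⊓ 𝓟 {ζ : ℂ | ζ.im ≤ 0}] fun ζ => ‖ζ‖ ^ M

/-! ### Pseudodifferential operators on tempered distributions -/

/-- `w ↦ ∫ a(z, 2πw) e^{2πi z·w} φ(z) dz`. With the Fourier transform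
`𝓕 f (w) = ∫ f(z) e^{-2πi z·w} dz` the operator with symbol `a` is
`A f (z) = (2π)^{-(n+1)} ∫ a(z, ζ) e^{i z·ζ} f̂(ζ) dζ = ∫ a(z, 2πw) e^{2πi z·w} 𝓕 f (w) dw`,
hence `∫ (A f) φ = ∫ (𝓕 f) (kernelTest a φ)`. -/
def kernelTest {n : ℕ} (a : Amb n → Amb n → ℂ) (φ : Amb n → ℂ) (w : Amb n) : ℂ :=
  ∫ z : Amb n, a z ((2 * Real.pi) • w) *
    Complex.exp (2 * Real.pi * Complex.I * (inner ℝ z w : ℝ)) * φ z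

open Classical in
/-- The distribution `A u`, where `A` is the pseudodifferential operator with symbol `a` and `u` is
a tempered distribution: `⟨A u, φ⟩ = ⟨𝓕 u, kernelTest a φ⟩` for test functions `φ`. If `a` is a
symbol and `φ` is smooth with compact support, then `kernelTest a φ` is a Schwartz function, as is
seen by integrating by parts, so that the second branch is not used. -/
def opApply {n : ℕ} (a : Amb n → Amb n → ℂ) (u : 𝓢'(Amb n, ℂ)) (φ : Amb n → ℂ) : ℂ :=
  if h : ∃ ψ : 𝓢(Amb n, ℂ), ∀ w, ψ w = kernelTest a φ w then (𝓕 u) h.choose else 0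

/-- The embedding `x ↦ (x, 0)` of the boundary. -/
def bdryIncl (n : ℕ) : Tang n →L[ℝ] Amb n :=
  ((WithLp.prodContinuousLinearEquiv 2 ℝ (Tang n) ℝ).symm : (Tang n × ℝ) →L[ℝ] Amb n).comp
    (ContinuousLinearMap.inl ℝ (Tang n) ℝ)

theorem bdryIncl_apply (n : ℕ) (x : Tang n) : bdryIncl n x = pt x 0 := rfl

theorem bdryIncl_antilipschitz (n : ℕ) : AntilipschitzWith 1 (bdryIncl n) := by
  apply Isometry.antilipschitz
  refine AddMonoidHomClass.isometry_of_norm (bdryIncl n) fun x => ?_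
  rw [bdryIncl_apply]
  simp

/-- Restriction of Schwartz functions to the boundary, `φ ↦ φ(·, 0)`. -/
def bdryRestrict (n : ℕ) : 𝓢(Amb n, ℂ) →L[ℂ] 𝓢(Tang n, ℂ) :=
  SchwartzMap.compCLMOfAntilipschitz ℂ (bdryIncl n).hasTemperateGrowth
    (bdryIncl_antilipschitz n)

/-- The tempered distribution `g_b(x) δ(ρ)`, that is `φ ↦ ⟨g_b, φ(·, 0)⟩`. -/
def tensorDelta {n : ℕ} (gb : 𝓢'(Tang n, ℂ)) : 𝓢'(Amb n, ℂ) :=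
  PointwiseConvergenceCLM.precomp ℂ (bdryRestrict n) gb

/-! ### Sobolev norms -/

/-- The `L²`-based Sobolev norm `‖u‖_{W^s}`: the `L²` norm of the Bessel potential
`𝓕⁻¹ (1 + |w|²)^{s/2} 𝓕 u`, and `∞` if the latter is not in `L²`. -/
def sobolevNorm {E : Type} [NormedAddCommGroup E] [InnerProductSpace ℝ E] [FiniteDimensional ℝ E]
    [MeasurableSpace E] [BorelSpace E] (s : ℝ) (u : 𝓢'(E, ℂ)) : ℝ≥0∞ :=
  ⨅ (f : Lp ℂ 2 (volume : Measure E)) (_ : besselPotential E ℂ s u = (f : 𝓢'(E, ℂ))), ‖f‖ₑ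

/-- The norm of `W^s` of the lower half-space `{ρ < 0}`, for a distribution given by its values on
test functions: the infimum of `‖F‖_{W^s(ℝⁿ⁺¹)}` over all `F` that coincide with `T` on `{ρ < 0}`
(and `∞` if there is no such `F` in `W^s(ℝⁿ⁺¹)`). -/
def lowerHalfSobolevNorm {n : ℕ} (s : ℝ) (T : (Amb n → ℂ) → ℂ) : ℝ≥0∞ :=
  ⨅ (F : 𝓢'(Amb n, ℂ)) (_ : ∀ φ : 𝓢(Amb n, ℂ), HasCompactSupport φ →
      tsupport φ ⊆ {z : Amb n | z.snd < 0} → F φ = T φ), sobolevNorm s F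

/-- The product `χ T` of a smooth function and a distribution given by its values on test
functions. -/
def cutoff {n : ℕ} (χ : Amb n → ℂ) (T : (Amb n → ℂ) → ℂ) (φ : Amb n → ℂ) : ℂ :=
  T (fun z => χ z * φ z)

end PsiDO

end

set_option maxSynthPendingDepth 3

/-! ### Mixed and joint derivatives -/

section JointDerivatives

variable {E X Y V : Type} [NormedAddCommGroup E] [NormedSpace ℝ E]
  [NormedAddCommGroup X] [NormedSpace ℝ X] [NormedAddCommGroup Y] [NormedSpace ℝ Y]
  [NormedAddCommGroup V] [NormedSpace ℝ V]

/-! The Fourier transform of $g_b(x)\delta(\rho)$ is $\hat g_b(\xi)$, constant in $\eta$. Testing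
$Ag$ against $\varphi$ therefore gives $\int \hat g_b(\xi)\int k_\varphi(\xi,\eta)\,d\eta\,d\xi$,
where $k_\varphi$ is `kernelTest a φ`. If $\varphi$ lives in $\rho\le 0$, the factor $e^{i\rho\eta}$
is bounded for $\operatorname{Im}\eta\le 0$, so any part of the symbol that extends holomorphically
in $\eta$ to the closed lower half-plane, with polynomial growth, contributes nothing to the inner
integral (`integral_kernelTest_pt_eq_zero`). The symbol may be changed by such terms.

Let $b=\prod_i(\eta-q_i)/(\eta-i(1+|\xi|))$. Its numerator cancels the poles of $a$ and its
denominator vanishes only in the upper half-plane, so $a-a(1-b)^M=ab\sum_{j<M}(1-b)^j$ is a term of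
that kind (`exists_extension`). On the other hand $1-b=O(d)$ with $d=(1+|\xi|)/|\eta-i(1+|\xi|)|$,
because $q_i$ has order 1. Hence $a(1-b)^M$ is $O((1+|\xi|)^k d^M)$ together with all its
$z$-derivatives (`isSmoothFamily_modSymbol`): it decays in $\eta$ as fast as desired.

For $M\ge s+1$ the Sobolev weight $(1+|\zeta|)^s$ times this size is at most a constant times
$(1+|\xi|)^{s+k}d$. Its $L^2$ norm in $\eta$ is of size $(1+|\xi|)^{s+k+1/2}$, which is where the
extra half derivative on $g_b$ comes from (`weight_le`, `lintegral_normalDecay_sq_pt`).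

The dependence on $z$ is handled without a symbol calculus. After multiplication by $\chi$ the
modified symbol is smooth and compactly supported in $z$, so its Fourier transform in $z$ decays
rapidly, and the full operator becomes an almost diagonal integral operator on the Fourier side,
bounded by Young's inequality (`exists_sobolevNorm_superposition_le`). The result is a distribution
on all of $\mathbb{R}^{n+1}$ that coincides with $\chi Ag$ for $\rho<0$.

Independently, $Ag$ has to be given its meaning: `kernelTest a φ` must be a Schwartz function
(`exists_schwartzMap_eq_kernelTest`). This is why mixed symbol estimates are first turned into
bounds on joint derivatives. -/

theorem ContDiff.iteratedFDeriv_infty {p : E → V} (hp : ContDiff ℝ ∞ p) (i : ℕ) :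
    ContDiff ℝ ∞ (iteratedFDeriv ℝ i p) :=
  hp.iteratedFDeriv_right (m := ∞) (i := i) (by exact_mod_cast le_top)

theorem ContDiff.fderiv_infty {p : E → V} (hp : ContDiff ℝ ∞ p) : ContDiff ℝ ∞ (fderiv ℝ p) :=
  hp.fderiv_right (m := ∞) (by exact_mod_cast le_top)

/-- Differentiation commutes with iterated differentiation. -/
theorem fderiv_iteratedFDeriv_comm {p : E → V} (hp : ContDiff ℝ ∞ p) (i : ℕ) (u v : E)
    (m : Fin i → E) :
    fderiv ℝ (iteratedFDeriv ℝ i p) u v m = iteratedFDeriv ℝ i (fderiv ℝ p) u m v := by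
  induction i generalizing u v with
  | zero =>
    rw [iteratedFDeriv_zero_apply]
    have h : (fun y => iteratedFDeriv ℝ 0 p y m) = p := by ext y; simp
    rw [← fderiv_continuousMultilinear_apply_const_apply
      ((hp.iteratedFDeriv_infty 0).differentiable (by simp) u), h]
  | succ i ih =>
    have hd : ∀ {G : Type} [NormedAddCommGroup G] [NormedSpace ℝ G] {f : E → G},
      ContDiff ℝ ∞ f → ∀ x, DifferentiableAt ℝ f x := fun h x => h.differentiable (by simp) x
    have hG := (hp.iteratedFDeriv_infty i).fderiv_infty
    have key : ∀ v w : E, ∀ m : Fin i → E,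
        fderiv ℝ (fun y => fderiv ℝ (iteratedFDeriv ℝ i p) y w m) u v
          = fderiv ℝ (fderiv ℝ (iteratedFDeriv ℝ i p)) u v w m := by
      intro v w m
      have h1 : HasFDerivAt (fun y => fderiv ℝ (iteratedFDeriv ℝ i p) y w)
          ((fderiv ℝ (fderiv ℝ (iteratedFDeriv ℝ i p)) u).flip w) u := by
        simpa using (hd hG u).hasFDerivAt.clm_apply (hasFDerivAt_const w u)
      rw [fderiv_continuousMultilinear_apply_const_apply h1.differentiableAt, h1.fderiv]
      simp
    have h1 : fderiv ℝ (iteratedFDeriv ℝ (i + 1) p) u v m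
        = fderiv ℝ (fun y => fderiv ℝ (iteratedFDeriv ℝ i p) y (m 0) (Fin.tail m)) u v := by
      rw [← fderiv_continuousMultilinear_apply_const_apply (hd (hp.iteratedFDeriv_infty (i + 1)) u)]
      rfl
    -- The new direction `v` is moved past the outermost one, `m 0`, by symmetry of the second
    -- derivative; the induction hypothesis moves it past the remaining ones.
    have hsymm : fderiv ℝ (fderiv ℝ (iteratedFDeriv ℝ i p)) u v (m 0)
        = fderiv ℝ (fderiv ℝ (iteratedFDeriv ℝ i p)) u (m 0) v := by
      have : IsSymmSndFDerivAt ℝ (iteratedFDeriv ℝ i p) u :=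
        (hp.iteratedFDeriv_infty i).contDiffAt.isSymmSndFDerivAt
          (by simpa using WithTop.coe_le_coe.2 (le_top : (2 : ℕ∞) ≤ ⊤))
      exact this v (m 0)
    rw [h1, key, hsymm, ← key]
    have h2 : (fun y => fderiv ℝ (iteratedFDeriv ℝ i p) y v (Fin.tail m))
        = fun y => iteratedFDeriv ℝ i (fderiv ℝ p) y (Fin.tail m) v := by
      ext y; exact ih y v _
    rw [h2, iteratedFDeriv_succ_apply_left]
    have hd' := hd (hp.fderiv_infty.iteratedFDeriv_infty i) u
    have h3 : HasFDerivAt (fun y => iteratedFDeriv ℝ i (fderiv ℝ p) y (Fin.tail m))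
        ((fderiv ℝ (iteratedFDeriv ℝ i (fderiv ℝ p)) u).flipMultilinear (Fin.tail m)) u :=
      hd'.hasFDerivAt.continuousMultilinear_apply_const _
    have h4 : HasFDerivAt (fun y => iteratedFDeriv ℝ i (fderiv ℝ p) y (Fin.tail m) v)
        (((fderiv ℝ (iteratedFDeriv ℝ i (fderiv ℝ p)) u).flipMultilinear (Fin.tail m)).flip v)
        u := by
      simpa using h3.clm_apply (hasFDerivAt_const v u)
    rw [h4.fderiv]
    simp

theorem iteratedFDeriv_slice_left {p : X × Y → V} (hp : ContDiff ℝ ∞ p) (i : ℕ) (z : X) (w : Y) :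
    iteratedFDeriv ℝ i (fun z' => p (z', w)) z =
      (iteratedFDeriv ℝ i p (z, w)).compContinuousLinearMap
        fun _ => ContinuousLinearMap.inl ℝ X Y := by
  have h : (fun z' => p (z', w))
      = (fun u => p (u + (0, w))) ∘ ContinuousLinearMap.inl ℝ X Y := by
    ext z'; simp
  rw [h, ContinuousLinearMap.iteratedFDeriv_comp_right (n := ∞) _ (by fun_prop) _
    (by exact_mod_cast le_top), iteratedFDeriv_comp_add_right]
  simp

theorem hasFDerivAt_slice_left {p : X × Y → V} {z : X} {w : Y}
    (hp : DifferentiableAt ℝ p (z, w)) :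
    HasFDerivAt (fun z' => p (z', w)) ((fderiv ℝ p (z, w)).comp (.inl ℝ X Y)) z :=
  HasFDerivAt.comp z (g := p) (f := fun z' => (z', w)) hp.hasFDerivAt (hasFDerivAt_prodMk_left z w)

theorem hasFDerivAt_slice_right {p : X × Y → V} {z : X} {w : Y}
    (hp : DifferentiableAt ℝ p (z, w)) :
    HasFDerivAt (fun w' => p (z, w')) ((fderiv ℝ p (z, w)).comp (.inr ℝ X Y)) w :=
  HasFDerivAt.comp w (g := p) (f := fun w' => (z, w')) hp.hasFDerivAt (hasFDerivAt_prodMk_right z w)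

/-- Interchanging one derivative in the second variable with derivatives in the first. -/
theorem iteratedFDeriv_fderiv_slice {p : X × Y → V} (hp : ContDiff ℝ ∞ p) (i : ℕ) (z : X) (w : Y) :
    iteratedFDeriv ℝ i (fun z' => (fderiv ℝ p (z', w)).comp (.inr ℝ X Y)) z =
      (fderiv ℝ (fun w' => iteratedFDeriv ℝ i (fun z' => p (z', w')) z) w).flipMultilinear := by
  ext m v
  have hQ : ContDiff ℝ ∞ fun u => (fderiv ℝ p u).comp (.inr ℝ X Y) :=
    hp.fderiv_infty.clm_comp contDiff_const
  rw [iteratedFDeriv_slice_left (p := fun u => (fderiv ℝ p u).comp (.inr ℝ X Y)) hQ]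
  have h1 : (fun u => (fderiv ℝ p u).comp (.inr ℝ X Y))
      = (ContinuousLinearMap.precomp V (ContinuousLinearMap.inr ℝ X Y)) ∘ fderiv ℝ p := rfl
  rw [h1, ContinuousLinearMap.iteratedFDeriv_comp_left (n := ∞) _ hp.fderiv_infty.contDiffAt
    (by exact_mod_cast le_top)]
  have h2 : (fun w' => iteratedFDeriv ℝ i (fun z' => p (z', w')) z)
      = fun w' => (iteratedFDeriv ℝ i p (z, w')).compContinuousLinearMap
        fun _ => ContinuousLinearMap.inl ℝ X Y := by
    ext1 w'; exact iteratedFDeriv_slice_left hp i z w'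
  rw [h2]
  let L : ((X × Y) [×i]→L[ℝ] V) →L[ℝ] (X [×i]→L[ℝ] V) :=
    ContinuousMultilinearMap.compContinuousLinearMapL fun _ => ContinuousLinearMap.inl ℝ X Y
  have h3 : HasFDerivAt (fun w' => (iteratedFDeriv ℝ i p (z, w')).compContinuousLinearMap
        fun _ => ContinuousLinearMap.inl ℝ X Y)
      (L.comp ((fderiv ℝ (iteratedFDeriv ℝ i p) (z, w)).comp (.inr ℝ X Y))) w := by
    have h := hasFDerivAt_slice_right (p := iteratedFDeriv ℝ i p) (z := z) (w := w)
        ((hp.iteratedFDeriv_infty i).differentiable (by simp) _)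
    exact (L.hasFDerivAt (x := iteratedFDeriv ℝ i p (z, w))).comp w h
  rw [h3.fderiv]
  simp only [ContinuousMultilinearMap.compContinuousLinearMap_apply,
    ContinuousLinearMap.compContinuousMultilinearMap_coe, Function.comp_apply,
    ContinuousLinearMap.precomp_apply, ContinuousLinearMap.comp_apply,
    ContinuousLinearMap.flipMultilinear_apply_apply,
    ContinuousMultilinearMap.compContinuousLinearMapL_apply, L]
  exact (fderiv_iteratedFDeriv_comm hp i (z, w) _ _).symm

/-- All mixed derivatives of `p`, those in the second variable being taken last, are bounded
on `K × Y`. -/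
def MixedBounded (K : Set X) (p : X × Y → V) : Prop :=
  ∀ i j : ℕ, ∃ C : ℝ, ∀ z ∈ K, ∀ w : Y,
    ‖iteratedFDeriv ℝ j (fun w' => iteratedFDeriv ℝ i (fun z' => p (z', w')) z) w‖ ≤ C

/-- All derivatives of `p` are bounded on `K × Y`. -/
def JointBounded (K : Set X) (p : X × Y → V) : Prop :=
  ∀ m : ℕ, ∃ C : ℝ, ∀ z ∈ K, ∀ w : Y, ‖iteratedFDeriv ℝ m p (z, w)‖ ≤ C

/-- A derivative in the first variable only raises `i` by one; the currying that relates the two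
forms is an isometry. -/
theorem MixedBounded.fderiv_left {K : Set X} {p : X × Y → V} (hp : ContDiff ℝ ∞ p)
    (h : MixedBounded K p) :
    MixedBounded K fun u : X × Y => (fderiv ℝ p u).comp (.inl ℝ X Y) := by
  intro i j
  obtain ⟨C, hC⟩ := h (i + 1) j
  refine ⟨C, fun z hz w => ?_⟩
  have h1 : ∀ w', (fun z' => (fderiv ℝ p (z', w')).comp (.inl ℝ X Y))
      = fderiv ℝ fun z' => p (z', w') := fun w' => by
    ext1 z'
    exact (hasFDerivAt_slice_left (hp.differentiable (by simp) _)).fderiv.symm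
  have h2 : (fun w' => iteratedFDeriv ℝ (i + 1) (fun z' => p (z', w')) z)
      = (continuousMultilinearCurryRightEquiv' ℝ i X V).symm ∘
        fun w' => iteratedFDeriv ℝ i (fun z' => (fderiv ℝ p (z', w')).comp (.inl ℝ X Y)) z := by
    ext1 w'
    rw [iteratedFDeriv_succ_eq_comp_right, Function.comp_apply, Function.comp_apply, h1]
  have h3 := hC z hz w
  rw [h2] at h3
  exact (LinearIsometryEquiv.norm_iteratedFDeriv_comp_left
    (continuousMultilinearCurryRightEquiv' ℝ i X V).symm _ w j).symm.trans_le h3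

/-- Here the new derivative in the second variable sits inside those in the first. It is brought
outside by `iteratedFDeriv_fderiv_slice`, at the cost of the norm of a fixed flip map. -/
theorem MixedBounded.fderiv_right {K : Set X} {p : X × Y → V} (hp : ContDiff ℝ ∞ p)
    (h : MixedBounded K p) :
    MixedBounded K fun u : X × Y => (fderiv ℝ p u).comp (.inr ℝ X Y) := by
  intro i j
  obtain ⟨C, hC⟩ := h i (j + 1)
  let Φ : (Y →L[ℝ] ContinuousMultilinearMap ℝ (fun _ : Fin i => X) V) →L[ℝ]
      ContinuousMultilinearMap ℝ (fun _ : Fin i => X) (Y →L[ℝ] V) :=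
    (ContinuousLinearMap.flipMultilinearEquiv ℝ (fun _ : Fin i => X) Y V).toContinuousLinearMap
  refine ⟨‖Φ‖ * C, fun z hz w => ?_⟩
  have hG : ContDiff ℝ ∞ fun w' => iteratedFDeriv ℝ i (fun z' => p (z', w')) z := by
    have : (fun w' => iteratedFDeriv ℝ i (fun z' => p (z', w')) z)
      = fun w' => ContinuousMultilinearMap.compContinuousLinearMapL
        (fun _ => ContinuousLinearMap.inl ℝ X Y) (iteratedFDeriv ℝ i p (z, w')) := by
      ext1 w'; exact iteratedFDeriv_slice_left hp i z w'
    rw [this]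
    exact (ContinuousLinearMap.contDiff _).comp
      ((hp.iteratedFDeriv_infty i).comp (contDiff_prodMk_right z))
  have h2 : (fun w' => iteratedFDeriv ℝ i
        (fun z' => (fderiv ℝ p (z', w')).comp (.inr ℝ X Y)) z)
      = Φ ∘ fderiv ℝ fun w' => iteratedFDeriv ℝ i (fun z' => p (z', w')) z := by
    ext1 w'; exact iteratedFDeriv_fderiv_slice hp i z w'
  rw [h2]
  refine (ContinuousLinearMap.norm_iteratedFDeriv_comp_left (N := ∞) _ hG.fderiv_infty.contDiffAt
    (by exact_mod_cast le_top)).trans ?_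
  rw [norm_iteratedFDeriv_fderiv]
  exact mul_le_mul_of_nonneg_left (hC z hz w) (norm_nonneg _)

theorem JointBounded.of_fderiv {K : Set X} {p : X × Y → V} {m : ℕ} {C : ℝ}
    (h : ∀ z ∈ K, ∀ w, ‖iteratedFDeriv ℝ m (fderiv ℝ p) (z, w)‖ ≤ C) :
    ∀ z ∈ K, ∀ w, ‖iteratedFDeriv ℝ (m + 1) p (z, w)‖ ≤ C := fun z hz w => by
  rw [← norm_iteratedFDeriv_fderiv]; exact h z hz w

/-- The total derivative is the sum of its two partial derivatives, and both of these are again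
mixed bounded. Induction on the order applies to them because the target space `V` is allowed to
vary. -/
theorem MixedBounded.jointBounded {K : Set X} {p : X × Y → V} (hp : ContDiff ℝ ∞ p)
    (h : MixedBounded K p) : JointBounded K p := by
  intro m
  induction m generalizing V with
  | zero =>
    obtain ⟨C, hC⟩ := h 0 0
    refine ⟨C, fun z hz w => ?_⟩
    simpa [norm_iteratedFDeriv_zero] using hC z hz w
  | succ m ih =>
    have hl : ContDiff ℝ ∞ fun u : X × Y => (fderiv ℝ p u).comp (.inl ℝ X Y) :=
      hp.fderiv_infty.clm_comp contDiff_const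
    have hr : ContDiff ℝ ∞ fun u : X × Y => (fderiv ℝ p u).comp (.inr ℝ X Y) :=
      hp.fderiv_infty.clm_comp contDiff_const
    obtain ⟨C₁, h₁⟩ := ih hl (h.fderiv_left hp)
    obtain ⟨C₂, h₂⟩ := ih hr (h.fderiv_right hp)
    let P₁ : (X →L[ℝ] V) →L[ℝ] (X × Y →L[ℝ] V) :=
      ContinuousLinearMap.precomp V (ContinuousLinearMap.fst ℝ X Y)
    let P₂ : (Y →L[ℝ] V) →L[ℝ] (X × Y →L[ℝ] V) :=
      ContinuousLinearMap.precomp V (ContinuousLinearMap.snd ℝ X Y)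
    refine ⟨‖P₁‖ * C₁ + ‖P₂‖ * C₂, JointBounded.of_fderiv fun z hz w => ?_⟩
    have hsplit : fderiv ℝ p = (P₁ ∘ fun u : X × Y => (fderiv ℝ p u).comp (.inl ℝ X Y))
        + (P₂ ∘ fun u : X × Y => (fderiv ℝ p u).comp (.inr ℝ X Y)) := by
      ext u v
      · simp [P₁, P₂, ContinuousLinearMap.precomp_apply, ← Prod.zero_eq_mk]
      · simp [P₁, P₂, ContinuousLinearMap.precomp_apply, ← Prod.zero_eq_mk]
    rw [hsplit, iteratedFDeriv_add_apply
      (((P₁.contDiff.comp hl).of_le (by exact_mod_cast le_top)).contDiffAt)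
      (((P₂.contDiff.comp hr).of_le (by exact_mod_cast le_top)).contDiffAt)]
    refine (norm_add_le _ _).trans (add_le_add ?_ ?_)
    · refine (P₁.norm_iteratedFDeriv_comp_left (N := ∞) hl.contDiffAt
        (by exact_mod_cast le_top)).trans ?_
      exact mul_le_mul_of_nonneg_left (h₁ z hz w) (norm_nonneg _)
    · refine (P₂.norm_iteratedFDeriv_comp_left (N := ∞) hr.contDiffAt
        (by exact_mod_cast le_top)).trans ?_
      exact mul_le_mul_of_nonneg_left (h₂ z hz w) (norm_nonneg _)

end JointDerivatives

/-! ### Oscillatory integrals with compactly supported amplitude -/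

section JointBoundedLemmas

variable {X Y V V' V'' : Type} [NormedAddCommGroup X] [NormedSpace ℝ X]
  [NormedAddCommGroup Y] [NormedSpace ℝ Y] [NormedAddCommGroup V] [NormedSpace ℝ V]
  [NormedAddCommGroup V'] [NormedSpace ℝ V'] [NormedAddCommGroup V''] [NormedSpace ℝ V'']

theorem JointBounded.clm_apply {K : Set X} {p : X × Y → V} {r : X × Y → V'}
    (B : V →L[ℝ] V' →L[ℝ] V'') (hp : ContDiff ℝ ∞ p) (hr : ContDiff ℝ ∞ r)
    (hpb : JointBounded K p) (hrb : JointBounded K r) :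
    JointBounded K fun u => B (p u) (r u) := by
  intro m
  choose C hC using hpb
  choose D hD using hrb
  refine ⟨‖B‖ * ∑ i ∈ Finset.range (m + 1), (m.choose i : ℝ) * |C i| * |D (m - i)|,
    fun z hz w => ?_⟩
  refine (B.norm_iteratedFDeriv_le_of_bilinear hp hr _ (by exact_mod_cast le_top)).trans ?_
  gcongr
  · exact (hC _ z hz w).trans (le_abs_self _)
  · exact (hD _ z hz w).trans (le_abs_self _)

theorem JointBounded.clm_comp {K : Set X} {p : X × Y → V} (L : V →L[ℝ] V')
    (hp : ContDiff ℝ ∞ p) (hpb : JointBounded K p) : JointBounded K fun u => L (p u) := by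
  intro m
  obtain ⟨C, hC⟩ := hpb m
  exact ⟨‖L‖ * C, fun z hz w => (L.norm_iteratedFDeriv_comp_left (N := ∞) hp.contDiffAt
    (by exact_mod_cast le_top)).trans (mul_le_mul_of_nonneg_left (hC z hz w) (norm_nonneg _))⟩

theorem JointBounded.add {K : Set X} {p r : X × Y → V} (hp : ContDiff ℝ ∞ p)
    (hr : ContDiff ℝ ∞ r) (hpb : JointBounded K p) (hrb : JointBounded K r) :
    JointBounded K fun u => p u + r u := by
  intro m
  obtain ⟨C, hC⟩ := hpb m
  obtain ⟨D, hD⟩ := hrb m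
  refine ⟨C + D, fun z hz w => ?_⟩
  have h := iteratedFDeriv_add_apply (𝕜 := ℝ) (i := m) (x := (z, w))
    ((hp.of_le (by exact_mod_cast le_top)).contDiffAt)
    ((hr.of_le (by exact_mod_cast le_top)).contDiffAt)
  calc _ = ‖iteratedFDeriv ℝ m (p + r) (z, w)‖ := rfl
    _ ≤ _ := by rw [h]; exact (norm_add_le _ _).trans (add_le_add (hC z hz w) (hD z hz w))

theorem JointBounded.comp_fst {K : Set X} (hK : IsCompact K) {F : X → V} (hF : ContDiff ℝ ∞ F) :
    JointBounded K fun u : X × Y => F u.1 := by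
  intro m
  obtain ⟨C, hC⟩ := hK.exists_bound_of_continuousOn
    (hF.continuous_iteratedFDeriv (m := m) (by exact_mod_cast le_top)).continuousOn
  refine ⟨C * ∏ _i : Fin m, ‖ContinuousLinearMap.fst ℝ X Y‖, fun z hz w => ?_⟩
  have h := (ContinuousLinearMap.fst ℝ X Y).iteratedFDeriv_comp_right hF (z, w)
    (i := m) (by exact_mod_cast le_top)
  calc _ = ‖iteratedFDeriv ℝ m (F ∘ ContinuousLinearMap.fst ℝ X Y) (z, w)‖ := rfl
    _ ≤ _ := by
      rw [h]
      refine (ContinuousMultilinearMap.norm_compContinuousLinearMap_le _ _).trans ?_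
      gcongr
      exact hC z hz

theorem JointBounded.comp_snd_clm {K : Set X} {p : X × Y → V} (hp : ContDiff ℝ ∞ p)
    (hpb : JointBounded K p) (L : Y →L[ℝ] Y) : JointBounded K fun u => p (u.1, L u.2) := by
  intro m
  obtain ⟨C, hC⟩ := hpb m
  let M : X × Y →L[ℝ] X × Y := (ContinuousLinearMap.id ℝ X).prodMap L
  refine ⟨C * ∏ _i : Fin m, ‖M‖, fun z hz w => ?_⟩
  have h := M.iteratedFDeriv_comp_right hp (z, w) (i := m) (by exact_mod_cast le_top)
  calc _ = ‖iteratedFDeriv ℝ m (p ∘ M) (z, w)‖ := rfl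
    _ ≤ _ := by
      rw [h]
      refine (ContinuousMultilinearMap.norm_compContinuousLinearMap_le _ _).trans ?_
      gcongr
      exact hC z hz (L w)

theorem JointBounded.fderiv_right {K : Set X} {p : X × Y → V} (hp : ContDiff ℝ ∞ p)
    (hpb : JointBounded K p) : JointBounded K fun u => (fderiv ℝ p u).comp (.inr ℝ X Y) := by
  have h : JointBounded K (fderiv ℝ p) := fun m => by
    obtain ⟨C, hC⟩ := hpb (m + 1)
    exact ⟨C, fun z hz w => by rw [norm_iteratedFDeriv_fderiv]; exact hC z hz w⟩
  let P : (X × Y →L[ℝ] V) →L[ℝ] (Y →L[ℝ] V) :=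
    ContinuousLinearMap.precomp V (ContinuousLinearMap.inr ℝ X Y)
  exact h.clm_comp P hp.fderiv_infty

end JointBoundedLemmas

/-! ### Amplitudes and the Schwartz decay of their oscillatory integrals -/

section Oscillatory

variable {E : Type} [NormedAddCommGroup E] [InnerProductSpace ℝ E]
  {V : Type} [NormedAddCommGroup V] [NormedSpace ℂ V]

theorem iteratedFDeriv_eq_zero_of_notMem {X : Type} [NormedAddCommGroup X] [NormedSpace ℝ X]
    {K : Set X} (hK : IsClosed K) {f : X → V} (hf : ∀ z ∉ K, f z = 0) (i : ℕ) {z : X}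
    (hz : z ∉ K) : iteratedFDeriv ℝ i f z = 0 := by
  have h : f =ᶠ[𝓝 z] fun _ => 0 := by
    filter_upwards [hK.isOpen_compl.mem_nhds hz] with y hy using hf y hy
  rw [h.iteratedFDeriv ℝ i |>.eq_of_nhds]
  simp

/-- Smooth amplitudes `p(z, w)` supported in `z ∈ K`, with bounded derivatives of all orders. -/
structure IsAmplitude (K : Set E) (p : E × E → V) : Prop where
  contDiff : ContDiff ℝ ∞ p
  support : ∀ z ∉ K, ∀ w, p (z, w) = 0
  bounded : JointBounded K p

theorem IsAmplitude.exists_bound {K : Set E} (hK : IsCompact K) {p : E × E → V}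
    (hp : IsAmplitude K p) (i : ℕ) : ∃ C : ℝ, 0 ≤ C ∧ ∀ u, ‖iteratedFDeriv ℝ i p u‖ ≤ C := by
  obtain ⟨C, hC⟩ := hp.bounded i
  refine ⟨|C|, abs_nonneg _, fun u => ?_⟩
  by_cases hz : u.1 ∈ K
  · exact (hC u.1 hz u.2).trans (le_abs_self _)
  · have := iteratedFDeriv_eq_zero_of_notMem (K := Prod.fst ⁻¹' K)
      (hK.isClosed.preimage continuous_fst) (fun v hv => hp.support v.1 hv v.2) i (z := u) hz
    rw [this, norm_zero]; exact abs_nonneg _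

/-- The amplitude of the derivative of an oscillatory integral. -/
noncomputable def derivAmplitude (p : E × E → V) (u : E × E) : E →L[ℝ] V :=
  (fderiv ℝ p u).comp (.inr ℝ E E) +
    ContinuousLinearMap.smulRightL ℝ E V (innerSL ℝ u.1) ((2 * Real.pi * Complex.I : ℂ) • p u)

/-- Differentiating the exponential brings down a factor $z$, which is harmless since $z$ stays in a
compact set. Amplitudes are thus stable under differentiation of the integral. -/
theorem IsAmplitude.deriv {K : Set E} (hK : IsCompact K) {p : E × E → V}
    (hp : IsAmplitude K p) : IsAmplitude K (derivAmplitude p) := by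
  have h1 : ContDiff ℝ ∞ fun u : E × E => innerSL ℝ u.1 :=
    (innerSL ℝ).contDiff.comp contDiff_fst
  have h2 : ContDiff ℝ ∞ fun u => (2 * Real.pi * Complex.I : ℂ) • p u :=
    contDiff_const.smul hp.contDiff
  have h3 : ContDiff ℝ ∞ fun u => (fderiv ℝ p u).comp (.inr ℝ E E) :=
    hp.contDiff.fderiv_infty.clm_comp contDiff_const
  have h4 : ContDiff ℝ ∞ fun u : E × E => ContinuousLinearMap.smulRightL ℝ E V (innerSL ℝ u.1)
      ((2 * Real.pi * Complex.I : ℂ) • p u) :=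
    ((ContinuousLinearMap.smulRightL ℝ E V).contDiff.comp h1).clm_apply h2
  refine ⟨h3.add h4, fun z hz w => ?_, ?_⟩
  · have h5 := iteratedFDeriv_eq_zero_of_notMem (K := Prod.fst ⁻¹' K)
      (hK.isClosed.preimage continuous_fst) (fun v hv => hp.support v.1 hv v.2) 1
      (z := (z, w)) hz
    have h6 : fderiv ℝ p (z, w) = 0 := by
      rw [← norm_eq_zero, ← norm_iteratedFDeriv_one, h5, norm_zero]
    simp [derivAmplitude, h6, hp.support z hz w]
  · refine JointBounded.add h3 h4 (hp.bounded.fderiv_right hp.contDiff) ?_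
    refine JointBounded.clm_apply (ContinuousLinearMap.smulRightL ℝ E V) h1 h2 ?_ ?_
    · exact JointBounded.comp_fst hK (innerSL ℝ).contDiff
    · exact hp.bounded.clm_comp (((2 * Real.pi * Complex.I : ℂ) • ContinuousLinearMap.id ℝ V))
        hp.contDiff

variable [FiniteDimensional ℝ E] [MeasurableSpace E] [BorelSpace E]

/-- Rapid decay of Fourier transforms of smooth functions supported in a fixed compact set, with
constants depending only on the size of the derivatives. -/
theorem exists_norm_pow_mul_norm_fourier_le {K : Set E} (hK : IsCompact K) (N : ℕ) :
    ∃ C : ℝ, 0 ≤ C ∧ ∀ (f : E → V) (A : ℝ), ContDiff ℝ ∞ f → (∀ z ∉ K, f z = 0) →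
      (∀ i ≤ N, ∀ z, ‖iteratedFDeriv ℝ i f z‖ ≤ A) → ∀ θ, ‖θ‖ ^ N * ‖𝓕 f θ‖ ≤ C * A := by
  obtain ⟨R, hR⟩ := hK.isBounded.exists_norm_le
  have hsupp : ∀ f : E → V, (∀ z ∉ K, f z = 0) → HasCompactSupport f := fun f hf =>
    HasCompactSupport.intro hK hf
  refine ⟨2 ^ N * ((N + 1 : ℕ) * volume.real K), by positivity,
    fun f A hf hfK hA θ => ?_⟩
  have hint : ∀ i : ℕ, Integrable (fun v => iteratedFDeriv ℝ i f v) := fun i =>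
    Continuous.integrable_of_hasCompactSupport
      (hf.continuous_iteratedFDeriv (m := i) (by exact_mod_cast le_top))
      ((hsupp f hfK).iteratedFDeriv (𝕜 := ℝ) i)
  have hcont : ∀ i : ℕ, Continuous (fun v => iteratedFDeriv ℝ i f v) := fun i =>
    hf.continuous_iteratedFDeriv (m := i) (by exact_mod_cast le_top)
  have h := Real.pow_mul_norm_iteratedFDeriv_fourier_le (K := 0) (N := ⊤) (f := f)
    (by exact_mod_cast hf)
    (fun k n _ _ => by
      refine ((continuous_norm.pow k).mul (hcont n).norm).integrable_of_hasCompactSupport ?_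
      exact ((hsupp f hfK).iteratedFDeriv (𝕜 := ℝ) n).norm.mul_left)
    (k := 0) (n := N) le_rfl le_top θ
  simp only [norm_iteratedFDeriv_zero] at h
  refine h.trans ?_
  have h2 : ∑ p ∈ Finset.range (0 + 1) ×ˢ Finset.range (N + 1),
      ∫ v, ‖v‖ ^ p.1 * ‖iteratedFDeriv ℝ p.2 f v‖ ≤
      ∑ p ∈ Finset.range (0 + 1) ×ˢ Finset.range (N + 1), A * volume.real K := by
    refine Finset.sum_le_sum fun p hp => ?_
    simp only [zero_add, Finset.mem_product, Finset.mem_range, Nat.lt_one_iff] at hp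
    rw [hp.1]
    simp only [pow_zero, one_mul]
    rw [← setIntegral_eq_integral_of_forall_compl_eq_zero (s := K) (fun z hz => by
      rw [iteratedFDeriv_eq_zero_of_notMem hK.isClosed hfK _ hz, norm_zero])]
    calc _ ≤ ∫ v in K, A := by
          refine setIntegral_mono_on (hint _).norm.integrableOn
            (integrableOn_const hK.measure_lt_top.ne) hK.measurableSet
            fun v _ => hA _ (by omega) v
      _ = _ := by simp [mul_comm]
  calc _ ≤ _ := mul_le_mul_of_nonneg_left h2 (by positivity)
    _ = _ := by simp; ring

/-- `∫ e^{2πi z·w} p(z, w) dz`. -/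
noncomputable def oscIntegral (p : E × E → V) (w : E) : V :=
  ∫ z : E, Complex.exp (2 * Real.pi * Complex.I * (inner ℝ z w : ℝ)) • p (z, w)

theorem oscIntegral_eq_fourier (p : E × E → V) (w : E) :
    oscIntegral p w = 𝓕 (fun z => p (z, w)) (-w) := by
  rw [Real.fourier_eq', oscIntegral]
  congr 1; ext z; congr 2; push_cast [inner_neg_right]; ring

/-- For frozen $w$ the integral is a Fourier transform evaluated at $-w$. The derivatives of the
slice are bounded uniformly in $w$, so the decay estimate holds on this diagonal too. -/
theorem IsAmplitude.exists_norm_pow_mul_oscIntegral_le {K : Set E} (hK : IsCompact K)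
    {p : E × E → V} (hp : IsAmplitude K p) (N : ℕ) :
    ∃ C : ℝ, ∀ w, ‖w‖ ^ N * ‖oscIntegral p w‖ ≤ C := by
  obtain ⟨C, hC0, hC⟩ := exists_norm_pow_mul_norm_fourier_le (V := V) hK N
  choose D hD0 hD using hp.exists_bound hK
  refine ⟨C * ∑ i ∈ Finset.range (N + 1), D i, fun w => ?_⟩
  rw [oscIntegral_eq_fourier, ← norm_neg w]
  refine hC (fun z => p (z, w)) _ (hp.contDiff.comp (contDiff_prodMk_left w))
    (fun z hz => hp.support z hz w) ?_ (-w)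
  intro i hi z
  rw [iteratedFDeriv_slice_left hp.contDiff]
  refine (ContinuousMultilinearMap.norm_compContinuousLinearMap_le _ _).trans ?_
  calc _ ≤ D i * 1 := by
        refine mul_le_mul (hD i _) ?_ (by positivity) (hD0 i)
        exact Finset.prod_le_one (fun _ _ => norm_nonneg _)
          fun _ _ => ContinuousLinearMap.norm_inl_le_one ℝ E E
    _ ≤ _ := by
        rw [mul_one]
        exact Finset.single_le_sum (fun i _ => hD0 i) (Finset.mem_range.2 (by omega))

theorem IsAmplitude.hasFDerivAt_oscIntegral {K : Set E} (hK : IsCompact K) {p : E × E → V}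
    (hp : IsAmplitude K p) (w : E) :
    HasFDerivAt (oscIntegral p) (oscIntegral (derivAmplitude p) w) w := by
  have hp' := hp.deriv hK
  obtain ⟨C, hC0, hC⟩ := hp'.exists_bound hK 0
  have hnorm : ∀ z w : E, ‖Complex.exp (2 * Real.pi * Complex.I * (inner ℝ z w : ℝ))‖ = 1 := by
    intro z w
    rw [show (2 * Real.pi * Complex.I * (inner ℝ z w : ℝ) : ℂ)
      = ((2 * Real.pi * inner ℝ z w : ℝ) : ℂ) * Complex.I by push_cast; ring]
    exact Complex.norm_exp_ofReal_mul_I _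
  have hcexp : Continuous fun u : E × E =>
      Complex.exp (2 * Real.pi * Complex.I * (inner ℝ u.1 u.2 : ℝ)) := by fun_prop
  -- The exponential has modulus one, so a constant on `K` dominates the differentiated integrand
  -- for all $w$ at once.
  refine hasFDerivAt_integral_of_dominated_of_fderiv_le (s := Set.univ)
    (bound := K.indicator fun _ => C)
    (F' := fun w z => Complex.exp (2 * Real.pi * Complex.I * (inner ℝ z w : ℝ)) •
      derivAmplitude p (z, w)) Filter.univ_mem (.of_forall fun w => ?_) ?_ ?_ ?_ ?_ ?_
  · exact ((hcexp.comp (Continuous.prodMk_left w)).smul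
      (hp.contDiff.continuous.comp (Continuous.prodMk_left w))).aestronglyMeasurable
  · refine ((hcexp.comp (Continuous.prodMk_left w)).smul
      (hp.contDiff.continuous.comp (Continuous.prodMk_left w))).integrable_of_hasCompactSupport ?_
    exact HasCompactSupport.intro hK fun z hz => by simp [hp.support z hz w]
  · exact ((hcexp.comp (Continuous.prodMk_left w)).smul
      (hp'.contDiff.continuous.comp (Continuous.prodMk_left w))).aestronglyMeasurable
  · refine .of_forall fun z w _ => ?_
    rw [norm_smul, hnorm, one_mul]
    by_cases hz : z ∈ K
    · simpa [hz] using hC (z, w)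
    · simp [hz, hp'.support z hz w]
  · exact (integrableOn_const hK.measure_lt_top.ne).integrable_indicator hK.measurableSet
  · refine .of_forall fun z w _ => ?_
    have h1 : HasFDerivAt (fun w => p (z, w)) _ w :=
      hasFDerivAt_slice_right (hp.contDiff.differentiable (by simp) (z, w))
    have h2 : HasFDerivAt (fun w : E => (2 * Real.pi * Complex.I * (inner ℝ z w : ℝ) : ℂ))
        ((innerSL ℝ z).smulRight (2 * Real.pi * Complex.I : ℂ)) w := by
      have := ((innerSL ℝ z).smulRight (2 * Real.pi * Complex.I : ℂ)).hasFDerivAt (x := w)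
      refine this.congr_of_eventuallyEq (.of_forall fun y => ?_)
      simp [mul_comm]
    refine (h2.cexp.smul h1).congr_fderiv ?_
    ext v
    have h3 : ∀ (ℓ : E →L[ℝ] ℝ) (y : V),
        ContinuousLinearMap.smulRightL ℝ E V ℓ y v = ℓ v • y := fun _ _ => rfl
    simp only [derivAmplitude, add_apply, smul_apply, ContinuousLinearMap.smulRight_apply,
      innerSL_apply_apply, h3, smul_add]
    congr 1
    simp only [← Complex.coe_smul, smul_smul, smul_eq_mul]

/-- Each derivative of the integral is the integral of another amplitude, with values in a larger
space. Smoothness and decay of all orders follow by induction from continuity and from the decay of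
the integral itself. -/
theorem IsAmplitude.exists_schwartzMap {K : Set E} (hK : IsCompact K) {p : E × E → V}
    (hp : IsAmplitude K p) : ∃ ψ : 𝓢(E, V), ∀ w, ψ w = oscIntegral p w := by
  have hsmooth : ∀ n : ℕ, ∀ {V : Type} [NormedAddCommGroup V] [NormedSpace ℂ V] {p : E × E → V},
      IsAmplitude K p → ContDiff ℝ n (oscIntegral p) := by
    intro n
    induction n with
    | zero =>
      intro V _ _ p hp
      exact contDiff_zero.2 (Differentiable.continuous (𝕜 := ℝ)
        fun w => (hp.hasFDerivAt_oscIntegral hK w).differentiableAt)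
    | succ n ih =>
      intro V _ _ p hp
      push_cast
      refine contDiff_succ_iff_hasFDerivAt.2 ⟨_, ih (hp.deriv hK),
        hp.hasFDerivAt_oscIntegral hK⟩
  have hdecay : ∀ n N : ℕ, ∀ {V : Type} [NormedAddCommGroup V] [NormedSpace ℂ V] {p : E × E → V},
      IsAmplitude K p → ∃ C, ∀ w, ‖w‖ ^ N * ‖iteratedFDeriv ℝ n (oscIntegral p) w‖ ≤ C := by
    intro n N
    induction n with
    | zero =>
      intro V _ _ p hp
      simpa using hp.exists_norm_pow_mul_oscIntegral_le hK N
    | succ n ih =>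
      intro V _ _ p hp
      obtain ⟨C, hC⟩ := ih (hp.deriv hK)
      refine ⟨C, fun w => ?_⟩
      rw [← norm_iteratedFDeriv_fderiv,
        show fderiv ℝ (oscIntegral p) = oscIntegral (derivAmplitude p) from
          funext fun w => (hp.hasFDerivAt_oscIntegral hK w).fderiv]
      exact hC w
  exact ⟨⟨oscIntegral p, contDiff_infty.2 fun n => hsmooth n hp,
    fun N n => hdecay n N hp⟩, fun w => rfl⟩

end Oscillatory

/-! ### Test kernels of symbols of nonpositive order -/

namespace PsiDO

/-- All exponents $m-j$ are nonpositive, so the symbol estimates reduce to plain bounds. -/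
theorem IsSymbol.jointBounded {X Ξ : Type} [NormedAddCommGroup X] [NormedSpace ℝ X]
    [NormedAddCommGroup Ξ] [NormedSpace ℝ Ξ] {m : ℝ} (hm : m ≤ 0) {p : X → Ξ → ℂ}
    (hp : IsSymbol m p) {K : Set X} (hK : IsCompact K) :
    JointBounded K fun u : X × Ξ => p u.1 u.2 := by
  refine MixedBounded.jointBounded hp.1 fun i j => ?_
  obtain ⟨C, hC⟩ := hp.2 K hK i j
  refine ⟨|C|, fun z hz w => (hC z hz w).trans ?_⟩
  have h0 : (1 : ℝ) ≤ 1 + ‖w‖ := by linarith [norm_nonneg w]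
  calc _ ≤ |C| * (1 + ‖w‖) ^ (m - j) := by gcongr; exact le_abs_self C
    _ ≤ |C| * 1 := by
      gcongr
      exact Real.rpow_le_one_of_one_le_of_nonpos h0 (by
        have : (0 : ℝ) ≤ j := by positivity
        linarith)
    _ = _ := mul_one _

theorem kernelTest_eq_oscIntegral {n : ℕ} (a : Amb n → Amb n → ℂ) (φ : Amb n → ℂ) (w : Amb n) :
    kernelTest a φ w = oscIntegral (fun u => a u.1 ((2 * Real.pi) • u.2) * φ u.1) w := by
  simp only [kernelTest, oscIntegral, smul_eq_mul]
  congr 1; ext z; ring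

theorem exists_schwartzMap_eq_kernelTest {n : ℕ} {k : ℝ} (hk : k ≤ 0) {a : Amb n → Amb n → ℂ}
    (ha : IsSymbol k a) {φ : Amb n → ℂ} (hφ : ContDiff ℝ ∞ φ) (hφc : HasCompactSupport φ) :
    ∃ ψ : 𝓢(Amb n, ℂ), ∀ w, ψ w = kernelTest a φ w := by
  let L : Amb n →L[ℝ] Amb n := (2 * Real.pi) • ContinuousLinearMap.id ℝ (Amb n)
  have h1 : ContDiff ℝ ∞ fun u : Amb n × Amb n => a u.1 (L u.2) :=
    ha.1.comp (contDiff_fst.prodMk (L.contDiff.comp contDiff_snd))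
  have hamp : IsAmplitude (tsupport φ)
      fun u : Amb n × Amb n => a u.1 ((2 * Real.pi) • u.2) * φ u.1 := by
    refine ⟨h1.mul (hφ.comp contDiff_fst), fun z hz w => ?_, ?_⟩
    · simp [image_eq_zero_of_notMem_tsupport hz]
    · exact JointBounded.clm_apply (ContinuousLinearMap.mul ℝ ℂ) h1 (hφ.comp contDiff_fst)
        ((ha.jointBounded hk hφc).comp_snd_clm ha.1 L) (JointBounded.comp_fst hφc hφ)
  obtain ⟨ψ, hψ⟩ := hamp.exists_schwartzMap hφc
  exact ⟨ψ, fun w => by rw [hψ, kernelTest_eq_oscIntegral]⟩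

end PsiDO

/-! ### Holomorphic functions in the lower half-plane -/

section LowerHalfPlane

open Complex

/-- Cauchy's theorem on the rectangle $[-R,R]\times[-R,0]$: the three lower sides have total length
$4R$ and the integrand there is at most $C/R^2$. -/
theorem integral_eq_zero_of_lowerHalfPlane_of_decay {f : ℂ → ℂ} {C : ℝ}
    (hd : DifferentiableOn ℂ f {ζ | ζ.im ≤ 0})
    (hC : ∀ ζ : ℂ, ζ.im ≤ 0 → ‖f ζ‖ ≤ C / (1 + ‖ζ‖ ^ 2)) : ∫ x : ℝ, f x = 0 := by
  have hC0 : 0 ≤ C := by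
    have := (norm_nonneg _).trans (hC 0 (by simp))
    simpa using this
  have hcont : Continuous fun x : ℝ => f x :=
    hd.continuousOn.comp_continuous continuous_ofReal (by simp)
  have hint : Integrable fun x : ℝ => f x := by
    refine (integrable_inv_one_add_sq.const_mul C).mono' hcont.aestronglyMeasurable
      (.of_forall fun x => ?_)
    have := hC x (by simp)
    rwa [norm_real, Real.norm_eq_abs, sq_abs, div_eq_mul_inv] at this
  have hlim := intervalIntegral_tendsto_integral hint tendsto_neg_atTop_atBot tendsto_id
  refine tendsto_nhds_unique hlim ?_
  refine squeeze_zero_norm' (a := fun R : ℝ => 4 * C / R) ?_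
    (tendsto_const_nhds.div_atTop tendsto_id)
  filter_upwards [eventually_gt_atTop 0] with R hR
  have hpt : ∀ ζ : ℂ, ζ.im ≤ 0 → R ≤ ‖ζ‖ → ‖f ζ‖ ≤ C / R ^ 2 := fun ζ hζ hRζ => by
    refine (hC ζ hζ).trans ?_
    gcongr
    nlinarith
  have hrect := integral_boundary_rect_eq_zero_of_differentiableOn f (-R - R * I) R
    (hd.mono fun ζ hζ => by
      simp only [sub_re, neg_re, ofReal_re, mul_re, I_re, mul_zero, ofReal_im, I_im, mul_one,
        sub_im, neg_im, mul_im, zero_sub, add_zero, sub_zero, neg_zero, mem_reProdIm] at hζ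
      have h := hζ.2
      rw [Set.uIcc_of_le (by linarith)] at h
      exact h.2)
  simp only [sub_re, neg_re, ofReal_re, mul_re, I_re, mul_zero, ofReal_im, I_im, mul_one,
    sub_im, neg_im, mul_im, zero_sub, add_zero, sub_zero, neg_zero, ofReal_neg, ofReal_zero,
    zero_mul] at hrect
  have h1 : ‖∫ x : ℝ in -R..R, f (x + -R * I)‖ ≤ C / R ^ 2 * |R - -R| :=
    intervalIntegral.norm_integral_le_of_norm_le_const fun x _ => by
      refine hpt _ (by simp [hR.le]) ?_
      refine le_trans ?_ (abs_im_le_norm _)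
      simp [abs_of_pos hR]
  have h2 : ‖∫ y : ℝ in -R..0, f (R + y * I)‖ ≤ C / R ^ 2 * |0 - -R| :=
    intervalIntegral.norm_integral_le_of_norm_le_const fun y hy => by
      rw [Set.uIoc_of_le (by linarith)] at hy
      refine hpt _ (by simpa using hy.2) ?_
      refine le_trans ?_ (abs_re_le_norm _)
      simp [abs_of_pos hR]
  have h3 : ‖∫ y : ℝ in -R..0, f (-R + y * I)‖ ≤ C / R ^ 2 * |0 - -R| :=
    intervalIntegral.norm_integral_le_of_norm_le_const fun y hy => by
      rw [Set.uIoc_of_le (by linarith)] at hy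
      refine hpt _ (by simpa using hy.2) ?_
      refine le_trans ?_ (abs_re_le_norm _)
      simp [abs_of_pos hR]
  have h4 : ∫ x : ℝ in -R..R, f x = (∫ x : ℝ in -R..R, f (x + -R * I)) +
      I • (∫ y : ℝ in -R..0, f (R + y * I)) - I • (∫ y : ℝ in -R..0, f (-R + y * I)) := by
    linear_combination -hrect
  rw [id, h4]
  rw [show |R - -R| = 2 * R by rw [abs_of_pos] <;> linarith] at h1
  rw [show |0 - -R| = R by rw [abs_of_pos] <;> linarith] at h2 h3
  calc _ ≤ C / R ^ 2 * (2 * R) + C / R ^ 2 * R + C / R ^ 2 * R := by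
        refine (norm_sub_le _ _).trans (add_le_add ((norm_add_le _ _).trans (add_le_add h1 ?_)) ?_)
        · rwa [norm_smul, norm_I, one_mul]
        · rwa [norm_smul, norm_I, one_mul]
    _ = _ := by field_simp; ring

/-- The factor $1+i\delta\zeta$ serves as a regularizer: its zero $i/\delta$ lies in the upper
half-plane, it grows linearly in the lower one, and it tends to $1$ as $\delta\to 0$. -/
theorem one_add_sq_le_norm_one_add_mul_I {ζ : ℂ} (hζ : ζ.im ≤ 0) {δ : ℝ} (hδ : 0 < δ) :
    1 + δ ^ 2 * ‖ζ‖ ^ 2 ≤ ‖1 + I * δ * ζ‖ ^ 2 := by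
  rw [← normSq_eq_norm_sq, ← normSq_eq_norm_sq, normSq_apply, normSq_apply]
  simp
  nlinarith

theorem one_le_norm_one_add_mul_I {ζ : ℂ} (hζ : ζ.im ≤ 0) {δ : ℝ} (hδ : 0 < δ) :
    1 ≤ ‖1 + I * δ * ζ‖ := by
  have h := one_add_sq_le_norm_one_add_mul_I hζ hδ
  have : 0 ≤ δ ^ 2 * ‖ζ‖ ^ 2 := by positivity
  nlinarith [norm_nonneg (1 + I * δ * ζ)]

theorem one_add_norm_le_mul_norm_one_add_mul_I {ζ : ℂ} (hζ : ζ.im ≤ 0) {δ : ℝ} (hδ : 0 < δ) :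
    1 + ‖ζ‖ ≤ (1 + 1 / δ) * ‖1 + I * δ * ζ‖ := by
  have h := one_add_sq_le_norm_one_add_mul_I hζ hδ
  have h1 := one_le_norm_one_add_mul_I hζ hδ
  have h2 : δ * ‖ζ‖ ≤ ‖1 + I * δ * ζ‖ :=
    abs_le_of_sq_le_sq' (by nlinarith) (norm_nonneg _) |>.2
  have h3 : ‖ζ‖ ≤ 1 / δ * ‖1 + I * δ * ζ‖ := by
    rw [one_div, ← div_eq_inv_mul, le_div_iff₀ hδ]; linarith
  linarith

/-- A function that is holomorphic and of polynomial growth in the closed lower half-plane and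
integrable on the real line has vanishing integral. -/
theorem integral_eq_zero_of_lowerHalfPlane {f : ℂ → ℂ} {C : ℝ} {M : ℕ}
    (hd : DifferentiableOn ℂ f {ζ | ζ.im ≤ 0})
    (hC : ∀ ζ : ℂ, ζ.im ≤ 0 → ‖f ζ‖ ≤ C * (1 + ‖ζ‖) ^ M)
    (hint : Integrable fun x : ℝ => f x) : ∫ x : ℝ, f x = 0 := by
  have hC0 : 0 ≤ C := by
    have := (norm_nonneg _).trans (hC 0 (by simp))
    simpa using this
  let δ : ℕ → ℝ := fun j => 1 / ((j : ℝ) + 1)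
  have hδ : ∀ j, 0 < δ j := fun j => by positivity
  have hδ1 : ∀ j, δ j ≤ 1 := fun j => by
    rw [div_le_one (by positivity)]; linarith [(Nat.cast_nonneg j : (0 : ℝ) ≤ j)]
  -- The power `M` absorbs the growth of `f`, and two more factors provide the quadratic decay
  -- needed for the contour argument.
  let F : ℕ → ℂ → ℂ := fun j ζ => f ζ / (1 + I * δ j * ζ) ^ (M + 2)
  have hne : ∀ j, ∀ ζ : ℂ, ζ.im ≤ 0 → (1 + I * δ j * ζ) ≠ 0 := fun j ζ hζ h => by
    have := one_le_norm_one_add_mul_I hζ (hδ j)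
    rw [h, norm_zero] at this
    linarith
  have hF0 : ∀ j, ∫ x : ℝ, F j x = 0 := by
    intro j
    refine integral_eq_zero_of_lowerHalfPlane_of_decay
      (C := C * (1 + 1 / δ j) ^ M * (1 / δ j ^ 2)) ?_ fun ζ hζ => ?_
    · exact hd.div (by fun_prop) fun ζ hζ => pow_ne_zero _ (hne j ζ hζ)
    · have h1 := one_le_norm_one_add_mul_I hζ (hδ j)
      have h2 := one_add_norm_le_mul_norm_one_add_mul_I hζ (hδ j)
      have h3 := one_add_sq_le_norm_one_add_mul_I hζ (hδ j)
      have h4 : δ j ^ 2 * (1 + ‖ζ‖ ^ 2) ≤ ‖1 + I * δ j * ζ‖ ^ 2 := by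
        have : δ j ^ 2 ≤ 1 := pow_le_one₀ (hδ j).le (hδ1 j)
        nlinarith
      simp only [F, norm_div, norm_pow]
      rw [div_le_iff₀ (by positivity)]
      calc ‖f ζ‖ ≤ C * (1 + ‖ζ‖) ^ M := hC ζ hζ
        _ ≤ C * ((1 + 1 / δ j) * ‖1 + I * δ j * ζ‖) ^ M := by gcongr
        _ = C * (1 + 1 / δ j) ^ M * (1 / δ j ^ 2) / (1 + ‖ζ‖ ^ 2) *
              (‖1 + I * δ j * ζ‖ ^ M * (δ j ^ 2 * (1 + ‖ζ‖ ^ 2))) := by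
            have := (hδ j).ne'
            rw [mul_pow]; field_simp
        _ ≤ _ := by
            rw [pow_add]
            have := hδ j
            gcongr
  have hlim : Tendsto (fun j => ∫ x : ℝ, F j x) atTop (𝓝 (∫ x : ℝ, f x)) := by
    refine tendsto_integral_of_dominated_convergence (fun x => ‖f x‖) (fun j => ?_) hint.norm
      (fun j => .of_forall fun x => ?_) (.of_forall fun x => ?_)
    · have hc : Continuous fun x : ℝ => (1 + I * δ j * (x : ℂ)) ^ (M + 2) := by fun_prop
      exact hint.aestronglyMeasurable.div₀ hc.aestronglyMeasurable
    · simp only [F, norm_div, norm_pow]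
      exact div_le_self (norm_nonneg _) (one_le_pow₀ (one_le_norm_one_add_mul_I (by simp) (hδ j)))
    · have h1 : Tendsto (fun j => (1 + I * δ j * (x : ℂ)) ^ (M + 2)) atTop
          (𝓝 ((1 + I * (0 : ℝ) * (x : ℂ)) ^ (M + 2))) := by
        have hδ0 : Tendsto δ atTop (𝓝 0) := tendsto_one_div_add_atTop_nhds_zero_nat
        have := (continuous_ofReal.tendsto 0).comp hδ0
        exact (((this.const_mul I).mul_const _).const_add _).pow _
      have h2 := (tendsto_const_nhds (x := f x)).div h1 (by simp)
      rw [ofReal_zero, mul_zero, zero_mul, add_zero, one_pow, div_one] at h2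
      exact h2
  exact tendsto_nhds_unique hlim (by simp [hF0])

/-- Clearing the poles of a meromorphic function. -/
theorem exists_entire_eq_mul_prod {ι : Type} [Fintype ι] {f : ℂ → ℂ} {q : ι → ℂ}
    (hf : ∀ ζ, MeromorphicAt f ζ) (han : ∀ ζ, (∀ i, q i ≠ ζ) → AnalyticAt ℂ f ζ)
    (hord : ∀ ζ, ((-(Nat.card {i : ι // q i = ζ} : ℤ) : ℤ) : WithTop ℤ) ≤ meromorphicOrderAt f ζ) :
    ∃ g : ℂ → ℂ, Differentiable ℂ g ∧ ∀ ζ, (∀ i, q i ≠ ζ) → g ζ = f ζ * ∏ i, (ζ - q i) := by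
  classical
  let P : ℂ → ℂ := fun ζ => ∏ i, (ζ - q i)
  have hP : ∀ ζ, AnalyticAt ℂ P ζ := fun ζ =>
    (Differentiable.analyticAt (by fun_prop) ζ)
  have hm : MeromorphicOn (f * P) Set.univ := fun ζ _ => (hf ζ).mul (hP ζ).meromorphicAt
  -- The product has nonnegative order everywhere, but its values at the former poles may be wrong.
  -- The normal form corrects them and leaves the product unchanged wherever it is analytic.
  refine ⟨toMeromorphicNFOn (f * P) Set.univ, fun ζ => ?_, fun ζ hζ => ?_⟩
  · have hnf := meromorphicNFOn_toMeromorphicNFOn (f * P) Set.univ (Set.mem_univ ζ)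
    refine (hnf.meromorphicOrderAt_nonneg_iff_analyticAt.1 ?_).differentiableAt
    rw [meromorphicOrderAt_toMeromorphicNFOn hm (Set.mem_univ ζ),
      meromorphicOrderAt_mul (hf ζ) (hP ζ).meromorphicAt]
    have hPo : ((Nat.card {i : ι // q i = ζ} : ℤ) : WithTop ℤ) ≤ meromorphicOrderAt P ζ := by
      have h1 : meromorphicOrderAt P ζ = ∑ i, meromorphicOrderAt (fun y => y - q i) ζ := by
        have := meromorphicOrderAt_fun_prod (x := ζ) (s := Finset.univ)
          (f := fun (i : ι) (y : ℂ) => y - q i) (fun i _ => by fun_prop)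
        exact this
      rw [h1, Nat.card_eq_fintype_card, Fintype.card_subtype]
      calc _ = ∑ i : ι, (if q i = ζ then (1 : WithTop ℤ) else 0) := by
            rw [Finset.sum_ite]; simp
        _ ≤ _ := by
          refine Finset.sum_le_sum fun i _ => ?_
          split_ifs with h
          · subst h
            exact (meromorphicOrderAt_id_sub_const (𝕜 := ℂ) (x := q i)).ge
          · exact (AnalyticAt.meromorphicOrderAt_nonneg (by fun_prop))
    calc (0 : WithTop ℤ) = ((-(Nat.card {i : ι // q i = ζ} : ℤ) : ℤ) : WithTop ℤ)
          + ((Nat.card {i : ι // q i = ζ} : ℤ) : WithTop ℤ) := by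
          rw [← WithTop.coe_add]; simp
      _ ≤ _ := add_le_add (hord ζ) hPo
  · rw [toMeromorphicNFOn_eq_toMeromorphicNFAt hm (Set.mem_univ ζ),
      toMeromorphicNFAt_eq_self.2 ((han ζ hζ).mul (hP ζ)).meromorphicNFAt]
    rfl

end LowerHalfPlane

/-! ### Families of smooth functions with derivatives of prescribed size -/

section SmoothFamily

variable {X Y : Type} [NormedAddCommGroup X] [NormedSpace ℝ X]

/-- `z ↦ p(z, y)` is smooth for each `y`, and its derivatives are `O(μ(y))` uniformly on `K`. -/
structure IsSmoothFamily (K : Set X) (μ : Y → ℝ) (p : X → Y → ℂ) : Prop where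
  contDiff : ∀ y, ContDiff ℝ ∞ fun z => p z y
  bound : ∀ i : ℕ, ∃ C : ℝ, 0 ≤ C ∧ ∀ z ∈ K, ∀ y, ‖iteratedFDeriv ℝ i (fun z => p z y) z‖ ≤ C * μ y

variable {K : Set X} {μ ν : Y → ℝ} {p r : X → Y → ℂ}

theorem IsSmoothFamily.mono (hp : IsSmoothFamily K μ p) (h : ∀ y, μ y ≤ ν y) :
    IsSmoothFamily K ν p := by
  refine ⟨hp.contDiff, fun i => ?_⟩
  obtain ⟨C, hC0, hC⟩ := hp.bound i
  exact ⟨C, hC0, fun z hz y => (hC z hz y).trans (mul_le_mul_of_nonneg_left (h y) hC0)⟩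

theorem IsSmoothFamily.add (hp : IsSmoothFamily K μ p) (hr : IsSmoothFamily K μ r) :
    IsSmoothFamily K μ fun z y => p z y + r z y := by
  refine ⟨fun y => (hp.contDiff y).add (hr.contDiff y), fun i => ?_⟩
  obtain ⟨C, hC0, hC⟩ := hp.bound i
  obtain ⟨D, hD0, hD⟩ := hr.bound i
  refine ⟨C + D, add_nonneg hC0 hD0, fun z hz y => ?_⟩
  have h := iteratedFDeriv_add_apply (𝕜 := ℝ) (i := i) (x := z)
    (((hp.contDiff y).of_le (by exact_mod_cast le_top)).contDiffAt)
    (((hr.contDiff y).of_le (by exact_mod_cast le_top)).contDiffAt)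
  calc _ = ‖iteratedFDeriv ℝ i ((fun z => p z y) + fun z => r z y) z‖ := rfl
    _ ≤ C * μ y + D * μ y := by
      rw [h]; exact (norm_add_le _ _).trans (add_le_add (hC z hz y) (hD z hz y))
    _ = _ := by ring

theorem IsSmoothFamily.mul (hμ : ∀ y, 0 ≤ μ y) (hp : IsSmoothFamily K μ p)
    (hr : IsSmoothFamily K ν r) :
    IsSmoothFamily K (fun y => μ y * ν y) fun z y => p z y * r z y := by
  refine ⟨fun y => (hp.contDiff y).mul (hr.contDiff y), fun i => ?_⟩
  choose C hC0 hC using hp.bound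
  choose D hD0 hD using hr.bound
  refine ⟨∑ j ∈ Finset.range (i + 1), (i.choose j : ℝ) * C j * D (i - j),
    Finset.sum_nonneg fun j _ => mul_nonneg (mul_nonneg (by positivity) (hC0 j)) (hD0 _),
    fun z hz y => ?_⟩
  refine (norm_iteratedFDeriv_mul_le (hp.contDiff y) (hr.contDiff y) z
    (by exact_mod_cast le_top)).trans ?_
  rw [Finset.sum_mul]
  refine Finset.sum_le_sum fun j _ => ?_
  calc _ ≤ (i.choose j : ℝ) * (C j * μ y) * (D (i - j) * ν y) := by
        refine mul_le_mul (mul_le_mul_of_nonneg_left (hC j z hz y) (by positivity))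
          (hD _ z hz y) (norm_nonneg _) ?_
        exact mul_nonneg (by positivity) (mul_nonneg (hC0 j) (hμ y))
    _ = _ := by ring

theorem IsSmoothFamily.of_const {c : Y → ℂ} : IsSmoothFamily K (fun y => ‖c y‖) fun _ y => c y := by
  refine ⟨fun y => contDiff_const, fun i => ⟨1, zero_le_one, fun z _ y => ?_⟩⟩
  rcases i with _ | i
  · simp
  · rw [iteratedFDeriv_const_of_ne (Nat.succ_ne_zero i)]; simp

theorem IsSmoothFamily.of_left (hK : IsCompact K) {F : X → ℂ} (hF : ContDiff ℝ ∞ F) :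
    IsSmoothFamily K (fun _ : Y => 1) fun z _ => F z := by
  refine ⟨fun _ => hF, fun i => ?_⟩
  obtain ⟨C, hC⟩ := hK.exists_bound_of_continuousOn
    (hF.continuous_iteratedFDeriv (m := i) (by exact_mod_cast le_top)).continuousOn
  exact ⟨|C|, abs_nonneg _, fun z hz y => (hC z hz).trans (by simpa using le_abs_self C)⟩

theorem IsSmoothFamily.pow (hμ : ∀ y, 0 ≤ μ y) (hp : IsSmoothFamily K μ p) (M : ℕ) :
    IsSmoothFamily K (fun y => μ y ^ M) fun z y => p z y ^ M := by
  induction M with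
  | zero =>
    have h := IsSmoothFamily.of_const (K := K) (c := fun _ : Y => 1)
    simpa using h
  | succ M ih =>
    simp only [pow_succ]
    exact ih.mul (fun y => pow_nonneg (hμ y) M) hp

theorem IsSmoothFamily.comp_right {Y' : Type} (hp : IsSmoothFamily K μ p) (g : Y' → Y) :
    IsSmoothFamily K (fun y => μ (g y)) fun z y => p z (g y) :=
  ⟨fun y => hp.contDiff (g y), fun i => by
    obtain ⟨C, hC0, hC⟩ := hp.bound i
    exact ⟨C, hC0, fun z hz y => hC z hz (g y)⟩⟩

/-- One factor at a time, $1-(1-d)P=(1-P)+(1-(1-P))\,d$. Since $\mu\le 1$, products of small terms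
are still $O(\mu)$. -/
theorem IsSmoothFamily.one_sub_prod (hμ : ∀ y, 0 ≤ μ y) (hμ1 : ∀ y, μ y ≤ 1) {ι : Type}
    (s : Finset ι) {d : ι → X → Y → ℂ} (hd : ∀ i, IsSmoothFamily K μ (d i)) :
    IsSmoothFamily K μ fun z y => 1 - ∏ i ∈ s, (1 - d i z y) := by
  classical
  have hone : IsSmoothFamily K (fun _ => (1 : ℝ)) fun (_ : X) (_ : Y) => (1 : ℂ) := by
    simpa using IsSmoothFamily.of_const (K := K) (c := fun _ : Y => 1)
  induction s using Finset.induction_on with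
  | empty =>
    have h : IsSmoothFamily K (fun _ => (0 : ℝ)) fun (_ : X) (_ : Y) => (0 : ℂ) := by
      simpa using IsSmoothFamily.of_const (K := K) (c := fun _ : Y => 0)
    simpa using h.mono hμ
  | insert i s hi ih =>
    have hneg : IsSmoothFamily K μ fun z y => (-1) * (1 - ∏ i ∈ s, (1 - d i z y)) := by
      have h := IsSmoothFamily.of_const (K := K) (c := fun _ : Y => -1)
      simpa using h.mul (fun _ => norm_nonneg _) ih
    have h1 := (hone.add (hneg.mono hμ1)).mul (fun _ => zero_le_one) (hd i)
    simp only [one_mul] at h1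
    have h2 := ih.add h1
    convert h2 using 3 with z y
    rw [Finset.prod_insert hi]; ring

end SmoothFamily

namespace PsiDO

theorem IsSymbol.isSmoothFamily {X Ξ : Type} [NormedAddCommGroup X] [NormedSpace ℝ X]
    [NormedAddCommGroup Ξ] [NormedSpace ℝ Ξ] {m : ℝ} {p : X → Ξ → ℂ}
    (hp : IsSymbol m p) {K : Set X} (hK : IsCompact K) :
    IsSmoothFamily K (fun ξ => (1 + ‖ξ‖) ^ m) p := by
  refine ⟨fun ξ => hp.1.comp (contDiff_prodMk_left ξ), fun i => ?_⟩
  obtain ⟨C, hC⟩ := hp.2 K hK i 0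
  refine ⟨|C|, abs_nonneg _, fun z hz ξ => ?_⟩
  have h := hC z hz ξ
  rw [norm_iteratedFDeriv_zero, Nat.cast_zero, sub_zero] at h
  exact h.trans (by gcongr; exact le_abs_self C)

/-! ### The modified symbol -/

/-- The size of the tangential covariable. -/
noncomputable def tangSize {n : ℕ} (ζ : Amb n) : ℝ := 1 + ‖ζ.fst‖

/-- `η - i (1 + |ξ|)`. -/
noncomputable def normalFactor {n : ℕ} (ζ : Amb n) : ℂ := ζ.snd - Complex.I * tangSize ζ

/-- `(1 + |ξ|) / |η - i (1 + |ξ|)|`. -/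
noncomputable def normalDecay {n : ℕ} (ζ : Amb n) : ℝ := tangSize ζ / ‖normalFactor ζ‖

/-- `∏ (η - q_i) / (η - i (1 + |ξ|))`. -/
noncomputable def blaschke {n N : ℕ} (q : Fin N → Amb n → Tang n → ℂ) (z ζ : Amb n) : ℂ :=
  ∏ i, (1 - (q i z ζ.fst - Complex.I * tangSize ζ) * (normalFactor ζ)⁻¹)

/-- A symbol that decays fast in the normal covariable and defines the same operator as `a` on
`g_b(x) δ(ρ)` in the lower half-space. -/
noncomputable def modSymbol {n N : ℕ} (a : Amb n → Amb n → ℂ)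
    (q : Fin N → Amb n → Tang n → ℂ) (M : ℕ) (z ζ : Amb n) : ℂ := a z ζ * (1 - blaschke q z ζ) ^ M

variable {n N : ℕ}

theorem one_le_tangSize (ζ : Amb n) : 1 ≤ tangSize ζ := by
  simp [tangSize]

theorem tangSize_pos (ζ : Amb n) : 0 < tangSize ζ := zero_lt_one.trans_le (one_le_tangSize ζ)

theorem norm_normalFactor_sq (ζ : Amb n) : ‖normalFactor ζ‖ ^ 2 = ζ.snd ^ 2 + tangSize ζ ^ 2 := by
  rw [← Complex.normSq_eq_norm_sq, Complex.normSq_apply, normalFactor]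
  simp
  ring

theorem tangSize_le_norm_normalFactor (ζ : Amb n) : tangSize ζ ≤ ‖normalFactor ζ‖ := by
  refine (abs_le_of_sq_le_sq' ?_ (norm_nonneg _)).2
  rw [norm_normalFactor_sq]; nlinarith [sq_nonneg ζ.snd]

theorem norm_normalFactor_pos (ζ : Amb n) : 0 < ‖normalFactor ζ‖ :=
  (tangSize_pos ζ).trans_le (tangSize_le_norm_normalFactor ζ)

theorem normalFactor_ne_zero (ζ : Amb n) : normalFactor ζ ≠ 0 :=
  norm_pos_iff.1 (norm_normalFactor_pos ζ)

theorem normalDecay_nonneg (ζ : Amb n) : 0 ≤ normalDecay ζ :=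
  div_nonneg (tangSize_pos ζ).le (norm_nonneg _)

theorem normalDecay_pos (ζ : Amb n) : 0 < normalDecay ζ :=
  div_pos (tangSize_pos ζ) (norm_normalFactor_pos ζ)

theorem normalDecay_le_one (ζ : Amb n) : normalDecay ζ ≤ 1 :=
  div_le_one_of_le₀ (tangSize_le_norm_normalFactor ζ) (norm_nonneg _)

theorem norm_fst_le (ζ : Amb n) : ‖ζ.fst‖ ≤ ‖ζ‖ := by
  refine (abs_le_of_sq_le_sq' ?_ (norm_nonneg _)).2
  rw [WithLp.prod_norm_sq_eq_of_L2]; nlinarith [sq_nonneg ‖ζ.snd‖]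

theorem tangSize_le_one_add_norm (ζ : Amb n) : tangSize ζ ≤ 1 + ‖ζ‖ := by
  have := norm_fst_le ζ
  rw [tangSize]; linarith

theorem one_add_norm_le_two_mul_norm_normalFactor (ζ : Amb n) :
    1 + ‖ζ‖ ≤ 2 * ‖normalFactor ζ‖ := by
  have h1 := norm_normalFactor_sq ζ
  have h2 : ‖ζ‖ ^ 2 = ‖ζ.fst‖ ^ 2 + ‖ζ.snd‖ ^ 2 := WithLp.prod_norm_sq_eq_of_L2 ζ
  rw [Real.norm_eq_abs, sq_abs] at h2
  have h3 : ‖ζ‖ ≤ ‖normalFactor ζ‖ := by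
    refine (abs_le_of_sq_le_sq' ?_ (norm_nonneg _)).2
    rw [h1, h2, tangSize]; nlinarith [norm_nonneg ζ.fst]
  have h4 := (one_le_tangSize ζ).trans (tangSize_le_norm_normalFactor ζ)
  linarith

@[fun_prop]
theorem continuous_tangSize : Continuous (tangSize : Amb n → ℝ) := by
  unfold tangSize; fun_prop

@[fun_prop]
theorem continuous_normalFactor : Continuous (normalFactor : Amb n → ℂ) := by
  unfold normalFactor; fun_prop

@[fun_prop]
theorem continuous_normalDecay : Continuous (normalDecay : Amb n → ℝ) := by
  unfold normalDecay
  exact continuous_tangSize.div (by fun_prop) fun ζ => (norm_normalFactor_pos ζ).ne'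

theorem continuous_blaschke {q : Fin N → Amb n → Tang n → ℂ} (hq : ∀ i, IsSymbol 1 (q i)) :
    Continuous fun u : Amb n × Amb n => blaschke q u.1 u.2 := by
  refine continuous_finsetProd _ fun i _ => ?_
  have h1 : Continuous fun u : Amb n × Amb n => q i u.1 u.2.fst :=
    (hq i).1.continuous.comp (g := fun w : Amb n × Tang n => q i w.1 w.2)
      (f := fun u : Amb n × Amb n => (u.1, u.2.fst)) (by fun_prop)
  have h2 : Continuous fun u : Amb n × Amb n => (normalFactor u.2)⁻¹ :=
    (continuous_normalFactor.comp continuous_snd).inv₀ fun u => normalFactor_ne_zero _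
  have h3 : Continuous fun u : Amb n × Amb n => (tangSize u.2 : ℂ) :=
    Complex.continuous_ofReal.comp (continuous_tangSize.comp continuous_snd)
  exact continuous_const.sub ((h1.sub (continuous_const.mul h3)).mul h2)

theorem continuous_modSymbol {k : ℝ} {a : Amb n → Amb n → ℂ} (ha : IsSymbol k a)
    {q : Fin N → Amb n → Tang n → ℂ} (hq : ∀ i, IsSymbol 1 (q i)) (M : ℕ) :
    Continuous fun u : Amb n × Amb n => modSymbol a q M u.1 u.2 :=
  ha.1.continuous.mul ((continuous_const.sub (continuous_blaschke hq)).pow M)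

/-- Both $q_i$ and $i(1+|\xi|)$ are of size $1+|\xi|$, so dividing by $\eta-i(1+|\xi|)$ gives
`normalDecay`. As $k\le 0$, the size of $a$ is at most $(1+|\xi|)^k$. Only $z$-derivatives are
counted, so the lack of smoothness of $|\xi|$ at the origin does not matter. -/
theorem isSmoothFamily_modSymbol {k : ℝ} (hk : k ≤ 0) {a : Amb n → Amb n → ℂ} (ha : IsSymbol k a)
    {q : Fin N → Amb n → Tang n → ℂ} (hq : ∀ i, IsSymbol 1 (q i)) (M : ℕ) {K : Set (Amb n)}
    (hK : IsCompact K) :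
    IsSmoothFamily K (fun ζ => tangSize ζ ^ k * normalDecay ζ ^ M) (modSymbol a q M) := by
  have hd : ∀ i, IsSmoothFamily K normalDecay fun z ζ : Amb n =>
      (q i z ζ.fst - Complex.I * tangSize ζ) * (normalFactor ζ)⁻¹ := by
    intro i
    have h1 : IsSmoothFamily K tangSize fun z ζ : Amb n => q i z ζ.fst := by
      have := ((hq i).isSmoothFamily hK).comp_right fun ζ : Amb n => ζ.fst
      simp only [Real.rpow_one] at this
      exact this
    have h2 : IsSmoothFamily K tangSize fun (_ : Amb n) (ζ : Amb n) =>
        -(Complex.I * tangSize ζ) := by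
      refine IsSmoothFamily.of_const.mono fun ζ => ?_
      simp [abs_of_pos (tangSize_pos ζ)]
    have h3 := (h1.add h2).mul (fun ζ => (tangSize_pos ζ).le)
      (IsSmoothFamily.of_const (K := K) (c := fun ζ : Amb n => (normalFactor ζ)⁻¹))
    have h4 : (fun ζ : Amb n => tangSize ζ * ‖(normalFactor ζ)⁻¹‖) = normalDecay := by
      ext ζ; rw [normalDecay, norm_inv, div_eq_mul_inv]
    rw [h4] at h3
    simpa only [sub_eq_add_neg] using h3
  have h1 := (IsSmoothFamily.one_sub_prod normalDecay_nonneg normalDecay_le_one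
    Finset.univ hd).pow normalDecay_nonneg M
  have h2 : IsSmoothFamily K (fun ζ => tangSize ζ ^ k) a := (ha.isSmoothFamily hK).mono fun ζ =>
    Real.rpow_le_rpow_of_nonpos (tangSize_pos ζ) (tangSize_le_one_add_norm ζ) hk
  exact h2.mul (fun ζ => Real.rpow_nonneg (tangSize_pos ζ).le k) h1

/-! ### Holomorphic extension of the difference of the symbols -/

theorem blaschke_pt (q : Fin N → Amb n → Tang n → ℂ) (z : Amb n) (ξ : Tang n) (η : ℝ) :
    blaschke q z (pt ξ η) =
      (∏ i, ((η : ℂ) - q i z ξ)) / ((η : ℂ) - Complex.I * (1 + ‖ξ‖ : ℝ)) ^ N := by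
  have h0 : (η : ℂ) - Complex.I * (1 + ‖ξ‖ : ℝ) ≠ 0 := normalFactor_ne_zero (pt ξ η)
  rw [blaschke, ← Fin.prod_const, ← Finset.prod_div_distrib]
  refine Finset.prod_congr rfl fun i _ => ?_
  change 1 - (q i z ξ - Complex.I * (1 + ‖ξ‖ : ℝ)) * ((η : ℂ) - Complex.I * (1 + ‖ξ‖ : ℝ))⁻¹ = _
  generalize (((1 + ‖ξ‖ : ℝ) : ℝ) : ℂ) = w at h0 ⊢
  field_simp
  ring

/-- The extension is $ab\sum_{j<M}(1-b)^j$, with $ab$ written as the entire function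
$a\prod_i(\eta-q_i)$ divided by $(\eta-i(1+|\xi|))^N$. This denominator has modulus at least $1$ in
the closed lower half-plane. -/
theorem exists_extension {a : Amb n → Amb n → ℂ}
    (ha : Continuous fun u : Amb n × Amb n => a u.1 u.2)
    {q : Fin N → Amb n → Tang n → ℂ} {aExt : Amb n → Tang n → ℂ → ℂ}
    (hExt : IsMeromorphicExtension a q aExt) (M : ℕ) (z : Amb n) (ξ : Tang n) :
    ∃ (G : ℂ → ℂ) (C : ℝ) (L : ℕ), DifferentiableOn ℂ G {ζ | ζ.im ≤ 0} ∧
      (∀ ζ : ℂ, ζ.im ≤ 0 → ‖G ζ‖ ≤ C * (1 + ‖ζ‖) ^ L) ∧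
      ∀ η : ℝ, G η = a z (pt ξ η) - modSymbol a q M z (pt ξ η) := by
  obtain ⟨g, hg, hgf⟩ := exists_entire_eq_mul_prod (hExt.meromorphic z ξ) (hExt.analytic z ξ)
    (hExt.pole_order z ξ)
  -- The identity with the cleared function is known only away from the $q_i$, and some of these may
  -- be real. They are finitely many, so density and continuity give it on the whole real line.
  have hgreal : ∀ η : ℝ, g η = a z (pt ξ η) * ∏ i, ((η : ℂ) - q i z ξ) := by
    have hfin : (Set.range fun i => (q i z ξ).re).Finite := Set.finite_range _
    have hdense : Dense (Set.range fun i => (q i z ξ).re)ᶜ := hfin.countable.dense_compl ℝ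
    have hpt : Continuous fun η : ℝ => a z (pt ξ η) :=
      ha.comp (f := fun η : ℝ => (z, pt ξ η)) (by fun_prop)
    refine congr_fun (Continuous.ext_on hdense (hg.continuous.comp Complex.continuous_ofReal)
      (hpt.mul (by fun_prop)) fun η hη => ?_)
    have h1 := hgf η fun i hi => hη ⟨i, by simp [hi]⟩
    rw [hExt.extends_symbol] at h1
    exact h1
  obtain ⟨M', hM'⟩ := hExt.growth z ξ
  obtain ⟨c, hc⟩ := hM'.bound
  rw [eventually_inf_principal, ← comap_norm_atTop, eventually_comap] at hc
  obtain ⟨R, hR⟩ := hc.exists_forall_of_atTop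
  let Q : ℝ := ∑ i, ‖q i z ξ‖
  have hQ : ∀ i, ‖q i z ξ‖ ≤ Q := fun i =>
    Finset.single_le_sum (f := fun i => ‖q i z ξ‖) (fun _ _ => norm_nonneg _) (Finset.mem_univ i)
  have hQ0 : 0 ≤ Q := Finset.sum_nonneg fun _ _ => norm_nonneg _
  -- Outside this ball no $q_i$ occurs and the growth bound on the extension of $a$ is in force;
  -- inside, the entire function is bounded by compactness.
  obtain ⟨B, hB⟩ := (isCompact_closedBall (0 : ℂ) (max R (Q + 1))).exists_bound_of_continuousOn
    hg.continuous.continuousOn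
  have hgb : ∀ ζ : ℂ, ζ.im ≤ 0 →
      ‖g ζ‖ ≤ (|B| + |c| * (1 + Q) ^ N) * (1 + ‖ζ‖) ^ (M' + N) := by
    intro ζ hζ
    have h1 : 1 ≤ (1 + ‖ζ‖) ^ (M' + N) := one_le_pow₀ (by linarith [norm_nonneg ζ])
    have h2 : 0 ≤ |c| * (1 + Q) ^ N := by positivity
    by_cases hζR : ‖ζ‖ ≤ max R (Q + 1)
    · calc ‖g ζ‖ ≤ |B| := (hB ζ (by simpa using hζR)).trans (le_abs_self B)
        _ ≤ |B| * (1 + ‖ζ‖) ^ (M' + N) := le_mul_of_one_le_right (abs_nonneg _) h1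
        _ ≤ _ := by gcongr; linarith
    · rw [not_le, max_lt_iff] at hζR
      rw [hgf ζ fun i hi => by
        have := hQ i
        rw [hi] at this; linarith [hζR.2], norm_mul, norm_prod]
      have h3 := hR ‖ζ‖ hζR.1.le ζ rfl hζ
      rw [norm_pow, norm_norm] at h3
      have h4 : ∏ i, ‖ζ - q i z ξ‖ ≤ ((1 + Q) * (1 + ‖ζ‖)) ^ N := by
        rw [← Fin.prod_const]
        refine Finset.prod_le_prod (fun _ _ => norm_nonneg _) fun i _ => ?_
        have := norm_sub_le ζ (q i z ξ)
        nlinarith [hQ i, norm_nonneg ζ]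
      calc _ ≤ (|c| * (1 + ‖ζ‖) ^ M') * ((1 + Q) * (1 + ‖ζ‖)) ^ N := by
            refine mul_le_mul (h3.trans ?_) h4 (Finset.prod_nonneg fun _ _ => norm_nonneg _)
              (by positivity)
            gcongr
            · exact le_abs_self c
            · linarith
        _ = |c| * (1 + Q) ^ N * (1 + ‖ζ‖) ^ (M' + N) := by rw [mul_pow, pow_add]; ring
        _ ≤ _ := by gcongr; linarith [abs_nonneg B]
  let W : ℝ := 1 + ‖ξ‖
  have hW : 1 ≤ W := by simp [W]
  have hden : ∀ ζ : ℂ, ζ.im ≤ 0 → 1 ≤ ‖ζ - Complex.I * W‖ := fun ζ hζ => by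
    refine le_trans ?_ (Complex.abs_im_le_norm _)
    rw [abs_of_nonpos] <;> simp <;> linarith
  have hden0 : ∀ ζ : ℂ, ζ.im ≤ 0 → ζ - Complex.I * W ≠ 0 := fun ζ hζ =>
    norm_pos_iff.1 (zero_lt_one.trans_le (hden ζ hζ))
  let E : ℂ → ℂ := fun ζ => (∏ i, (ζ - q i z ξ)) / (ζ - Complex.I * W) ^ N
  have hEd : DifferentiableOn ℂ E {ζ | ζ.im ≤ 0} :=
    DifferentiableOn.div (by fun_prop) (by fun_prop) fun ζ hζ => pow_ne_zero _ (hden0 ζ hζ)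
  have hEb : ∀ ζ : ℂ, ζ.im ≤ 0 → ‖E ζ‖ ≤ (1 + (Q + W)) ^ N := by
    intro ζ hζ
    have hpos := zero_lt_one.trans_le (hden ζ hζ)
    simp only [E, norm_div, norm_pow, norm_prod]
    rw [div_le_iff₀ (by positivity), ← mul_pow, ← Fin.prod_const]
    refine Finset.prod_le_prod (fun _ _ => norm_nonneg _) fun i _ => ?_
    have h1 : ‖ζ - q i z ξ‖ ≤ ‖ζ - Complex.I * W‖ + (W + Q) := by
      have h2 : ζ - q i z ξ = (ζ - Complex.I * W) + (Complex.I * W - q i z ξ) := by ring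
      rw [h2]
      refine (norm_add_le _ _).trans (add_le_add_right ((norm_sub_le _ _).trans ?_) _)
      refine add_le_add ?_ (hQ i)
      simp [abs_of_pos (zero_lt_one.trans_le hW)]
    nlinarith [hden ζ hζ]
  let S : ℝ := ∑ j ∈ Finset.range M, (1 + (1 + (Q + W)) ^ N) ^ j
  have hSb : ∀ ζ : ℂ, ζ.im ≤ 0 → ‖∑ j ∈ Finset.range M, (1 - E ζ) ^ j‖ ≤ S := fun ζ hζ => by
    refine (norm_sum_le _ _).trans (Finset.sum_le_sum fun j _ => ?_)
    rw [norm_pow]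
    gcongr
    exact (norm_sub_le _ _).trans (by simpa using hEb ζ hζ)
  refine ⟨fun ζ => g ζ / (ζ - Complex.I * W) ^ N * ∑ j ∈ Finset.range M, (1 - E ζ) ^ j,
    (|B| + |c| * (1 + Q) ^ N) * S, M' + N, ?_, fun ζ hζ => ?_, fun η => ?_⟩
  · refine (hg.differentiableOn.div (by fun_prop) fun ζ hζ => pow_ne_zero _ (hden0 ζ hζ)).mul ?_
    exact DifferentiableOn.fun_sum fun j _ => ((differentiableOn_const _).sub hEd).pow j
  · rw [norm_mul, norm_div, norm_pow]
    calc _ ≤ ‖g ζ‖ * S := by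
          refine mul_le_mul (div_le_self (norm_nonneg _) (one_le_pow₀ (hden ζ hζ))) (hSb ζ hζ)
            (norm_nonneg _) (norm_nonneg _)
      _ ≤ (|B| + |c| * (1 + Q) ^ N) * (1 + ‖ζ‖) ^ (M' + N) * S := by
          refine mul_le_mul_of_nonneg_right (hgb ζ hζ) ?_
          exact (norm_nonneg _).trans (hSb ζ hζ)
      _ = _ := by ring
  · have h1 : E η = blaschke q z (pt ξ η) := (blaschke_pt q z ξ η).symm
    -- The geometric sum turns $E\sum_{j<M}(1-E)^j$ into $1-(1-E)^M$.
    have h2 := mul_geom_sum (1 - E η) M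
    change g η / ((η : ℂ) - Complex.I * W) ^ N * ∑ j ∈ Finset.range M, (1 - E η) ^ j = _
    rw [hgreal, modSymbol, ← h1]
    have h3 : a z (pt ξ η) * (∏ i, ((η : ℂ) - q i z ξ)) / ((η : ℂ) - Complex.I * W) ^ N
        = a z (pt ξ η) * E η := mul_div_assoc _ _ _
    rw [h3]
    linear_combination (-a z (pt ξ η)) * h2

end PsiDO

/-! ### Sobolev bounds for superpositions of modulated functions -/

section Schur

variable {α : Type} [MeasurableSpace α]

/-- Cauchy–Schwarz after splitting $\kappa U=\kappa^{1/2}\cdot\kappa^{1/2}U$; the first step of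
Young's inequality. -/
theorem lintegral_mul_sq_le {μ : Measure α} {κ U : α → ℝ≥0∞} (hκ : Measurable κ)
    (hU : Measurable U) :
    (∫⁻ w, κ w * U w ∂μ) ^ 2 ≤ (∫⁻ w, κ w ∂μ) * ∫⁻ w, κ w * U w ^ 2 ∂μ := by
  have h2 : Real.HolderConjugate 2 2 := Real.HolderConjugate.two_two
  have h := ENNReal.lintegral_mul_le_Lp_mul_Lq μ h2 (f := fun w => κ w ^ (1 / 2 : ℝ))
    (g := fun w => κ w ^ (1 / 2 : ℝ) * U w) (by fun_prop) (by fun_prop)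
  have hsq : ∀ x : ℝ≥0∞, x ^ (1 / 2 : ℝ) * x ^ (1 / 2 : ℝ) = x := fun x => by
    rw [← ENNReal.rpow_add_of_nonneg _ _ (by norm_num) (by norm_num)]; norm_num
  have hsq' : ∀ x : ℝ≥0∞, (x ^ (1 / 2 : ℝ)) ^ 2 = x := fun x => by rw [sq, hsq]
  simp only [Pi.mul_apply, ENNReal.rpow_two, ← mul_assoc, hsq, mul_pow, hsq'] at h
  calc _ ≤ ((∫⁻ w, κ w ∂μ) ^ (1 / 2 : ℝ) * (∫⁻ w, κ w * U w ^ 2 ∂μ) ^ (1 / 2 : ℝ)) ^ 2 := by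
        gcongr
    _ = _ := by rw [mul_pow, hsq', hsq']

variable {E : Type} [NormedAddCommGroup E] [InnerProductSpace ℝ E] [FiniteDimensional ℝ E]
  [MeasurableSpace E] [BorelSpace E]

/-- Young's inequality for the convolution of an integrable and a square integrable function. -/
theorem lintegral_sq_lintegral_sub_mul_le {κ U : E → ℝ≥0∞} (hκ : Measurable κ)
    (hU : Measurable U) :
    ∫⁻ τ, (∫⁻ w, κ (τ - w) * U w) ^ 2 ≤ (∫⁻ θ, κ θ) ^ 2 * ∫⁻ w, U w ^ 2 := by
  calc _ ≤ ∫⁻ τ, (∫⁻ θ, κ θ) * ∫⁻ w, κ (τ - w) * U w ^ 2 := by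
        refine lintegral_mono fun τ => ?_
        refine (lintegral_mul_sq_le (κ := fun w => κ (τ - w)) (by fun_prop) hU).trans ?_
        rw [lintegral_sub_left_eq_self κ τ]
    _ = (∫⁻ θ, κ θ) * ∫⁻ w, ∫⁻ τ, κ (τ - w) * U w ^ 2 := by
        rw [lintegral_const_mul _ (Measurable.lintegral_prod_right
          (f := fun τ w => κ (τ - w) * U w ^ 2) (by fun_prop)),
          lintegral_lintegral_swap (by fun_prop)]
    _ = _ := by
        have h : ∀ w, ∫⁻ τ, κ (τ - w) * U w ^ 2 = (∫⁻ θ, κ θ) * U w ^ 2 := fun w => by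
          rw [lintegral_mul_const _ (by fun_prop), lintegral_sub_right_eq_self κ w]
        simp_rw [h]
        rw [lintegral_const_mul _ (by fun_prop), ← mul_assoc, sq]

end Schur

/-! ### Superpositions on the Fourier side -/

section Superposition

/-- Peetre's inequality: it moves the Sobolev weight from the output frequency `τ` to the input
frequency `w`, at the cost of a power of $1+|\tau-w|$. -/
theorem one_add_norm_le_mul {E : Type} [SeminormedAddCommGroup E] (τ w : E) :
    1 + ‖τ‖ ≤ (1 + ‖τ - w‖) * (1 + ‖w‖) := by
  have h : ‖τ‖ ≤ ‖τ - w‖ + ‖w‖ := by simpa using norm_add_le (τ - w) w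
  nlinarith [norm_nonneg (τ - w), norm_nonneg w, mul_nonneg (norm_nonneg (τ - w)) (norm_nonneg w)]

variable {E : Type} [NormedAddCommGroup E] [InnerProductSpace ℝ E] [FiniteDimensional ℝ E]
  [MeasurableSpace E] [BorelSpace E]

/-- The Fourier transform of `∫ v(w) f(z, w) e^{2πi z·w} dw`. -/
noncomputable def superFourier (f : E → E → ℂ) (v : E → ℂ) (τ : E) : ℂ :=
  ∫ w, 𝓕 (fun z => f z w) (τ - w) * v w

theorem stronglyMeasurable_fourier_slice {f : E → E → ℂ}
    (hf : Continuous fun u : E × E => f u.1 u.2) :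
    StronglyMeasurable fun u : E × E => 𝓕 (fun z => f z u.2) (u.1 - u.2) := by
  simp_rw [Real.fourier_eq']
  refine StronglyMeasurable.integral_prod_right (ν := volume)
    (f := fun (u : E × E) (z : E) => Complex.exp ((-2 * Real.pi * inner ℝ z (u.1 - u.2) : ℝ)
      * Complex.I) • f z u.2) (Continuous.stronglyMeasurable ?_)
  have h : Continuous fun u : (E × E) × E => f u.2 u.1.2 :=
    hf.comp (f := fun u : (E × E) × E => (u.2, u.1.2)) (by fun_prop)
  have h2 : Continuous fun u : (E × E) × E =>
      Complex.exp ((-2 * Real.pi * inner ℝ u.2 (u.1.1 - u.1.2) : ℝ) * Complex.I) := by fun_prop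
  exact h2.smul h

variable {K : Set E} {μ : E → ℝ} {f : E → E → ℂ}

/-- Bounds for the powers $0$ and $N$ of $|\theta|$ are combined by $(1+t)^N\le 2^N(1+t^N)$. The
constants depend on the parameter only through $\mu$. -/
theorem IsSmoothFamily.exists_norm_fourier_le (hK : IsCompact K)
    (hf : IsSmoothFamily Set.univ μ f) (hμ : ∀ w, 0 ≤ μ w) (hfK : ∀ z ∉ K, ∀ w, f z w = 0)
    (N : ℕ) :
    ∃ C : ℝ, 0 ≤ C ∧ ∀ θ w, (1 + ‖θ‖) ^ N * ‖𝓕 (fun z => f z w) θ‖ ≤ C * μ w := by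
  have key : ∀ N : ℕ, ∃ C : ℝ, 0 ≤ C ∧ ∀ θ w, ‖θ‖ ^ N * ‖𝓕 (fun z => f z w) θ‖ ≤ C * μ w := by
    intro N
    obtain ⟨C, hC0, hC⟩ := exists_norm_pow_mul_norm_fourier_le (V := ℂ) hK N
    choose D hD0 hD using hf.bound
    refine ⟨C * ∑ i ∈ Finset.range (N + 1), D i,
      mul_nonneg hC0 (Finset.sum_nonneg fun i _ => hD0 i), fun θ w => ?_⟩
    rw [mul_assoc]
    refine hC (fun z => f z w) _ (hf.contDiff w) (fun z hz => hfK z hz w) (fun i hi z => ?_) θ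
    refine (hD i z (Set.mem_univ z) w).trans ?_
    gcongr
    · exact hμ w
    · exact Finset.single_le_sum (fun i _ => hD0 i) (Finset.mem_range.2 (by omega))
  obtain ⟨C, hC0, hC⟩ := key 0
  obtain ⟨D, hD0, hD⟩ := key N
  refine ⟨2 ^ N * (C + D), by positivity, fun θ w => ?_⟩
  have h1 : (1 + ‖θ‖) ^ N ≤ 2 ^ N * (1 + ‖θ‖ ^ N) := by
    rcases le_total ‖θ‖ 1 with h | h
    · calc (1 + ‖θ‖) ^ N ≤ 2 ^ N := by gcongr; linarith
        _ ≤ _ := le_mul_of_one_le_right (by positivity) (by simp)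
    · calc (1 + ‖θ‖) ^ N ≤ (2 * ‖θ‖) ^ N := by gcongr; linarith
        _ ≤ _ := by rw [mul_pow]; gcongr; simp
  calc _ ≤ 2 ^ N * (1 + ‖θ‖ ^ N) * ‖𝓕 (fun z => f z w) θ‖ := by gcongr
    _ = 2 ^ N * (‖θ‖ ^ 0 * ‖𝓕 (fun z => f z w) θ‖ + ‖θ‖ ^ N * ‖𝓕 (fun z => f z w) θ‖) := by
        rw [pow_zero]; ring
    _ ≤ 2 ^ N * (C * μ w + D * μ w) := by
        exact mul_le_mul_of_nonneg_left (add_le_add (hC θ w) (hD θ w)) (by positivity)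
    _ = _ := by ring

/-- Pointwise bound for the integrand of `superFourier`, with the weight of `W^s`. -/
theorem IsSmoothFamily.exists_weighted_enorm_le (hK : IsCompact K)
    (hf : IsSmoothFamily Set.univ μ f) (hμ : ∀ w, 0 ≤ μ w) (hfK : ∀ z ∉ K, ∀ w, f z w = 0)
    {s : ℝ} (hs : 0 ≤ s) :
    ∃ κ : E → ℝ≥0∞, Measurable κ ∧ ∫⁻ θ, κ θ ≠ ⊤ ∧ ∀ (v : E → ℂ) (τ w : E),
      ENNReal.ofReal ((1 + ‖τ‖) ^ s) * ‖𝓕 (fun z => f z w) (τ - w) * v w‖ₑ ≤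
        κ (τ - w) * (ENNReal.ofReal ((1 + ‖w‖) ^ s * μ w) * ‖v w‖ₑ) := by
  -- After Peetre's inequality costs `s` powers, more than the dimension remain, so that the
  -- convolution kernel `κ` is integrable.
  obtain ⟨N, hN⟩ := exists_nat_gt (s + Module.finrank ℝ E)
  obtain ⟨C, hC0, hC⟩ := hf.exists_norm_fourier_le hK hμ hfK N
  have hint : Integrable fun θ : E => C * (1 + ‖θ‖) ^ (-(N - s)) :=
    (integrable_one_add_norm (by linarith)).const_mul C
  refine ⟨fun θ => ENNReal.ofReal (C * (1 + ‖θ‖) ^ (-(N - s))), by fun_prop,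
    hint.lintegral_lt_top.ne, fun v τ w => ?_⟩
  rw [enorm_mul, ← mul_assoc, ← mul_assoc, ← ofReal_norm, ← ENNReal.ofReal_mul (by positivity),
    ← ENNReal.ofReal_mul (by positivity)]
  refine mul_le_mul' (ENNReal.ofReal_le_ofReal ?_) le_rfl
  set θ := τ - w
  have h1 : (1 + ‖τ‖) ^ s ≤ (1 + ‖θ‖) ^ s * (1 + ‖w‖) ^ s := by
    rw [← Real.mul_rpow (by positivity) (by positivity)]
    exact Real.rpow_le_rpow (by positivity) (one_add_norm_le_mul τ w) hs
  have hpos : 0 < 1 + ‖θ‖ := by positivity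
  have h2 : ‖𝓕 (fun z => f z w) θ‖ ≤ C * μ w * (1 + ‖θ‖) ^ (-N : ℝ) := by
    have := hC θ w
    rw [Real.rpow_neg hpos.le, Real.rpow_natCast, ← div_eq_mul_inv, le_div_iff₀ (by positivity)]
    linarith
  calc _ ≤ ((1 + ‖θ‖) ^ s * (1 + ‖w‖) ^ s) * (C * μ w * (1 + ‖θ‖) ^ (-N : ℝ)) := by gcongr
    _ = C * ((1 + ‖θ‖) ^ s * (1 + ‖θ‖) ^ (-N : ℝ)) * ((1 + ‖w‖) ^ s * μ w) := by ring
    _ = _ := by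
      rw [← Real.rpow_add hpos, show s + -(N : ℝ) = -(N - s) by ring]

theorem fourier_slice_sub {f : E → ℂ} (τ w : E) :
    𝓕 f (τ - w) =
      𝓕 (fun z => Complex.exp (2 * Real.pi * Complex.I * (inner ℝ z w : ℝ)) * f z) τ := by
  rw [Real.fourier_eq', Real.fourier_eq']
  congr 1; ext z
  rw [smul_eq_mul, smul_eq_mul, ← mul_assoc, ← Complex.exp_add]
  congr 2
  push_cast [inner_sub_right]; ring

/-- The Fourier transform is its own transpose, for a modulated function and a Schwartz function. -/
theorem integral_fourier_sub_mul {f : E → ℂ} (hf : Continuous f) (hfc : HasCompactSupport f)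
    (φ : 𝓢(E, ℂ)) (w : E) :
    ∫ τ, 𝓕 f (τ - w) * (𝓕⁻ φ : 𝓢(E, ℂ)) τ =
      ∫ z, f z * Complex.exp (2 * Real.pi * Complex.I * (inner ℝ z w : ℝ)) * φ z := by
  have hcont : Continuous fun z =>
      Complex.exp (2 * Real.pi * Complex.I * (inner ℝ z w : ℝ)) * f z := by fun_prop
  have hint : Integrable fun z =>
      Complex.exp (2 * Real.pi * Complex.I * (inner ℝ z w : ℝ)) * f z :=
    hcont.integrable_of_hasCompactSupport hfc.mul_left
  have h := VectorFourier.integral_fourierIntegral_smul_eq_flip (L := innerₗ E)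
      Real.continuous_fourierChar continuous_inner hint
      (SchwartzMap.integrable (μ := volume) (𝓕⁻ φ : 𝓢(E, ℂ)))
  simp only [smul_eq_mul] at h
  have h2 : 𝓕 (𝓕⁻ φ) = φ := fourier_fourierInv_eq φ
  have h3 : ∀ z, VectorFourier.fourierIntegral Real.fourierChar volume (innerₗ E).flip
      (𝓕⁻ φ : 𝓢(E, ℂ)) z
      = φ z := fun z => by
    conv_rhs => rw [← h2, fourier_coe]
    simp [Real.fourier_eq, VectorFourier.fourierIntegral]
  simp_rw [h3] at h
  simp_rw [fourier_slice_sub]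
  refine h.trans ?_
  congr 1; ext z; ring

namespace PsiDO

/-- Bessel potentials of opposite orders cancel, so `f` itself is a competitor in the infimum. -/
theorem sobolevNorm_besselPotential_neg_le (s : ℝ) (f : Lp ℂ 2 (volume : Measure E)) :
    sobolevNorm s (besselPotential E ℂ (-s) (f : 𝓢'(E, ℂ))) ≤ ‖f‖ₑ := by
  refine iInf₂_le f ?_
  rw [besselPotential_besselPotential_apply]
  simp

/-- The distribution whose Fourier transform is `(1 + |w|²)^{-s/2} H(w)`. -/
theorem besselPotential_neg_fourierInv_apply (s : ℝ) (H : Lp ℂ 2 (volume : Measure E))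
    (φ : 𝓢(E, ℂ)) :
    besselPotential E ℂ (-s) ((𝓕⁻ H : Lp ℂ 2 (volume : Measure E)) : 𝓢'(E, ℂ)) φ =
      ∫ τ, ((1 + ‖τ‖ ^ 2) ^ (-s / 2) : ℝ) * (𝓕⁻ φ : 𝓢(E, ℂ)) τ * H τ := by
  rw [besselPotential, TemperedDistribution.fourierMultiplierCLM_apply,
    Lp.fourier_toTemperedDistribution_eq, fourier_fourierInv_eq,
    TemperedDistribution.fourierInv_apply, TemperedDistribution.smulLeftCLM_apply_apply,
    Lp.toTemperedDistribution_apply]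
  congr 1; ext τ
  rw [SchwartzMap.smulLeftCLM_apply_apply (by fun_prop)]
  simp

/-- **Sobolev bound for superpositions.** -/
theorem exists_sobolevNorm_superposition_le (hK : IsCompact K)
    (hfc : Continuous fun u : E × E => f u.1 u.2)
    (hf : IsSmoothFamily Set.univ μ f) (hμc : Measurable μ) (hμ : ∀ w, 0 ≤ μ w)
    (hfK : ∀ z ∉ K, ∀ w, f z w = 0) {s : ℝ} (hs : 0 ≤ s) :
    ∃ C : ℝ≥0, ∀ v : E → ℂ, StronglyMeasurable v →
      ∫⁻ w, (ENNReal.ofReal ((1 + ‖w‖) ^ s * μ w) * ‖v w‖ₑ) ^ 2 ≠ ⊤ →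
      ∃ F : 𝓢'(E, ℂ), sobolevNorm s F ≤
          C * (∫⁻ w, (ENNReal.ofReal ((1 + ‖w‖) ^ s * μ w) * ‖v w‖ₑ) ^ 2) ^ (1 / 2 : ℝ) ∧
        ∀ φ : 𝓢(E, ℂ),
          Integrable (fun w => v w * ∫ z, f z w *
            Complex.exp (2 * Real.pi * Complex.I * (inner ℝ z w : ℝ)) * φ z) ∧
          F φ = ∫ w, v w * ∫ z, f z w *
            Complex.exp (2 * Real.pi * Complex.I * (inner ℝ z w : ℝ)) * φ z := by
  obtain ⟨κ, hκm, hκ, hbd⟩ := hf.exists_weighted_enorm_le hK hμ hfK hs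
  lift ∫⁻ θ, κ θ to ℝ≥0 using hκ with C hC
  refine ⟨C, fun v hv hvfin => ?_⟩
  set U : E → ℝ≥0∞ := fun w => ENNReal.ofReal ((1 + ‖w‖) ^ s * μ w) * ‖v w‖ₑ
  have hUm : Measurable U := by
    have := hv.measurable.enorm
    fun_prop
  have hGm : StronglyMeasurable fun u : E × E =>
      𝓕 (fun z => f z u.2) (u.1 - u.2) * v u.2 :=
    (stronglyMeasurable_fourier_slice hfc).mul (hv.comp_measurable measurable_snd)
  have hYoung := lintegral_sq_lintegral_sub_mul_le hκm hUm
  rw [← hC] at hYoung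
  -- `H` is the $L^2$ function whose norm is to be the Sobolev norm of the superposition. It is
  -- dominated pointwise by the convolution of `κ` with the weighted density `U`.
  let H : E → ℂ := fun τ => ((1 + ‖τ‖ ^ 2) ^ (s / 2) : ℝ) * superFourier f v τ
  have hHm : AEStronglyMeasurable H := by
    have h1 : StronglyMeasurable (superFourier f v) :=
      StronglyMeasurable.integral_prod_right (ν := volume)
        (f := fun τ w : E => 𝓕 (fun z => f z w) (τ - w) * v w) hGm
    have h2 : Continuous fun τ : E => (((1 + ‖τ‖ ^ 2) ^ (s / 2) : ℝ) : ℂ) :=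
      Complex.continuous_ofReal.comp (Continuous.rpow_const (by fun_prop)
        fun τ => Or.inl (by positivity))
    exact h2.aestronglyMeasurable.mul h1.aestronglyMeasurable
  have hweight : ∀ τ : E, (1 + ‖τ‖ ^ 2) ^ (s / 2) ≤ (1 + ‖τ‖) ^ s := fun τ => by
    have : (1 + ‖τ‖) ^ s = ((1 + ‖τ‖) ^ 2) ^ (s / 2) := by
      rw [← Real.rpow_natCast, ← Real.rpow_mul (by positivity)]; congr 1; push_cast; ring
    rw [this]
    exact Real.rpow_le_rpow (by positivity) (by nlinarith [norm_nonneg τ]) (by positivity)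
  have hHb : ∀ τ, ‖H τ‖ₑ ≤ ∫⁻ w, κ (τ - w) * U w := fun τ => by
    calc ‖H τ‖ₑ ≤ ENNReal.ofReal ((1 + ‖τ‖) ^ s) *
          ∫⁻ w, ‖𝓕 (fun z => f z w) (τ - w) * v w‖ₑ := by
          rw [enorm_mul]
          gcongr
          · rw [← ofReal_norm, Complex.norm_real, Real.norm_of_nonneg (by positivity)]
            exact ENNReal.ofReal_le_ofReal (hweight τ)
          · exact enorm_integral_le_lintegral_enorm (fun w => 𝓕 (fun z => f z w) (τ - w) * v w)
      _ = ∫⁻ w, ENNReal.ofReal ((1 + ‖τ‖) ^ s) * ‖𝓕 (fun z => f z w) (τ - w) * v w‖ₑ := by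
          rw [lintegral_const_mul']; exact ENNReal.ofReal_ne_top
      _ ≤ _ := lintegral_mono fun w => hbd v τ w
  have hHnorm : eLpNorm H 2 volume ≤ C * (∫⁻ w, U w ^ 2) ^ (1 / 2 : ℝ) := by
    rw [eLpNorm_eq_lintegral_rpow_enorm_toReal (by norm_num) (by norm_num)]
    simp only [ENNReal.toReal_ofNat, ENNReal.rpow_two]
    calc _ ≤ ((C : ℝ≥0∞) ^ 2 * ∫⁻ w, U w ^ 2) ^ (1 / 2 : ℝ) := by
          refine ENNReal.rpow_le_rpow ((lintegral_mono fun τ => ?_).trans hYoung) (by norm_num)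
          gcongr
          exact hHb τ
      _ = _ := by
          rw [ENNReal.mul_rpow_of_nonneg _ _ (by norm_num), ← ENNReal.rpow_natCast,
            ← ENNReal.rpow_mul]
          norm_num
  have hHL : MemLp H 2 volume := by
    refine ⟨hHm, hHnorm.trans_lt ?_⟩
    exact ENNReal.mul_lt_top ENNReal.coe_lt_top
      (ENNReal.rpow_lt_top_of_nonneg (by norm_num) hvfin)
  refine ⟨besselPotential E ℂ (-s)
    ((𝓕⁻ (hHL.toLp H) : Lp ℂ 2 (volume : Measure E)) : 𝓢'(E, ℂ)), ?_, fun φ => ?_⟩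
  · refine (sobolevNorm_besselPotential_neg_le s _).trans ?_
    have h1 : ‖(𝓕⁻ (hHL.toLp H) : Lp ℂ 2 (volume : Measure E))‖ₑ = ‖hHL.toLp H‖ₑ := by
      rw [← ofReal_norm, ← ofReal_norm, ← Lp.norm_fourier_eq, fourier_fourierInv_eq]
    rw [h1, Lp.enorm_toLp]
    exact hHnorm
  -- Fubini is justified by pairing the $L^2$ function `𝓕⁻ φ` with the convolution, which is in
  -- $L^2$ by Young. The weight in `hbd` is at least $1$ because $s\ge 0$ and may be dropped.
  · have hFub : Integrable (fun u : E × E => (𝓕⁻ φ : 𝓢(E, ℂ)) u.1 *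
        (𝓕 (fun z => f z u.2) (u.1 - u.2) * v u.2)) (volume.prod volume) := by
      have hm : AEStronglyMeasurable (fun u : E × E => (𝓕⁻ φ : 𝓢(E, ℂ)) u.1 *
          (𝓕 (fun z => f z u.2) (u.1 - u.2) * v u.2)) (volume.prod volume) :=
        (((𝓕⁻ φ : 𝓢(E, ℂ)).continuous.comp continuous_fst).aestronglyMeasurable).mul
          hGm.aestronglyMeasurable
      refine ⟨hm, ?_⟩
      rw [hasFiniteIntegral_iff_enorm, lintegral_prod _ hm.enorm]
      have hφm : Measurable fun τ => ‖(𝓕⁻ φ : 𝓢(E, ℂ)) τ‖ₑ :=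
        (𝓕⁻ φ : 𝓢(E, ℂ)).continuous.measurable.enorm
      have hgm : Measurable fun τ => ∫⁻ w, κ (τ - w) * U w :=
        Measurable.lintegral_prod_right (f := fun τ w => κ (τ - w) * U w) (by fun_prop)
      calc _ ≤ ∫⁻ τ, ‖(𝓕⁻ φ : 𝓢(E, ℂ)) τ‖ₑ * ∫⁻ w, κ (τ - w) * U w := by
            refine lintegral_mono fun τ => ?_
            simp_rw [enorm_mul ((𝓕⁻ φ : 𝓢(E, ℂ)) τ)]
            rw [lintegral_const_mul' _ _ enorm_ne_top]
            gcongr with w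
            refine le_trans ?_ (hbd v τ w)
            refine le_mul_of_one_le_left zero_le ?_
            rw [← ENNReal.ofReal_one]
            exact ENNReal.ofReal_le_ofReal
              (Real.one_le_rpow (by linarith [norm_nonneg τ]) hs)
        _ ≤ (∫⁻ τ, ‖(𝓕⁻ φ : 𝓢(E, ℂ)) τ‖ₑ ^ (2 : ℝ)) ^ (1 / (2 : ℝ)) *
              (∫⁻ τ, (∫⁻ w, κ (τ - w) * U w) ^ (2 : ℝ)) ^ (1 / (2 : ℝ)) :=
            ENNReal.lintegral_mul_le_Lp_mul_Lq _ Real.HolderConjugate.two_two hφm.aemeasurable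
              hgm.aemeasurable
        _ < ⊤ := by
            refine ENNReal.mul_lt_top ?_ (ENNReal.rpow_lt_top_of_nonneg (by norm_num) ?_)
            · have h1 := (𝓕⁻ φ : 𝓢(E, ℂ)).eLpNorm_lt_top 2 (volume : Measure E)
              rw [eLpNorm_eq_lintegral_rpow_enorm_toReal (by norm_num) (by norm_num)] at h1
              simpa using h1
            · simp only [ENNReal.rpow_two]
              exact (hYoung.trans_lt (ENNReal.mul_lt_top
                (ENNReal.pow_lt_top ENNReal.coe_lt_top) hvfin.lt_top)).ne
    have hslice : ∀ w, ∫ τ, (𝓕⁻ φ : 𝓢(E, ℂ)) τ * (𝓕 (fun z => f z w) (τ - w) * v w) =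
        v w * ∫ z, f z w * Complex.exp (2 * Real.pi * Complex.I * (inner ℝ z w : ℝ)) * φ z := by
      intro w
      rw [← integral_fourier_sub_mul (hf.contDiff w).continuous
        (HasCompactSupport.intro hK fun z hz => hfK z hz w), ← integral_const_mul]
      congr 1; ext τ; ring
    have hI := hFub.integral_prod_right
    simp only [hslice] at hI
    refine ⟨hI, ?_⟩
    rw [besselPotential_neg_fourierInv_apply]
    have h1 : ∫ τ, ((1 + ‖τ‖ ^ 2) ^ (-s / 2) : ℝ) * (𝓕⁻ φ : 𝓢(E, ℂ)) τ * (hHL.toLp H) τ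
        = ∫ τ, ∫ w, (𝓕⁻ φ : 𝓢(E, ℂ)) τ * (𝓕 (fun z => f z w) (τ - w) * v w) := by
      refine integral_congr_ae ?_
      filter_upwards [hHL.coeFn_toLp] with τ hτ
      rw [hτ, integral_const_mul]
      have h2 : ((1 + ‖τ‖ ^ 2) ^ (-s / 2) : ℝ) * ((1 + ‖τ‖ ^ 2) ^ (s / 2) : ℝ) = 1 := by
        rw [← Real.rpow_add (by positivity)]
        simp [neg_div]
      have h3 : (((1 + ‖τ‖ ^ 2) ^ (-s / 2) : ℝ) : ℂ) * (((1 + ‖τ‖ ^ 2) ^ (s / 2) : ℝ) : ℂ) = 1 := by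
        rw [← Complex.ofReal_mul, h2, Complex.ofReal_one]
      simp only [H, superFourier]
      linear_combination ((𝓕⁻ φ : 𝓢(E, ℂ)) τ * ∫ w, 𝓕 (fun z => f z w) (τ - w) * v w) * h3
    rw [h1, integral_integral_swap hFub]
    simp only [hslice]

end PsiDO

end Superposition

/-! ### Symbols that are holomorphic in the lower half-plane -/

namespace PsiDO

variable {n : ℕ}

theorem inner_pt (z : Amb n) (ξ : Tang n) (η : ℝ) :
    inner ℝ z (pt ξ η) = inner ℝ z.fst ξ + z.snd * η := by
  rw [WithLp.prod_inner_apply]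
  simp [mul_comm]

theorem smul_pt (c : ℝ) (ξ : Tang n) (η : ℝ) : c • pt ξ η = pt (c • ξ) (c * η) := rfl

/-- If `b` extends holomorphically, with polynomial bounds, in the normal covariable to the lower
half-plane, then `∫ kernelTest b φ (ξ, η) dη = 0` for test functions `φ` on `{ρ ≤ 0}`. -/
theorem integral_kernelTest_pt_eq_zero {b : Amb n → Amb n → ℂ}
    (hb : Continuous fun u : Amb n × Amb n => b u.1 u.2) {φ : Amb n → ℂ} (hφ : Continuous φ)
    (hφc : HasCompactSupport φ) (hφs : ∀ z, φ z ≠ 0 → z.snd ≤ 0) {B : ℝ}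
    (hB : ∀ z, φ z ≠ 0 → ∀ w, ‖b z w‖ ≤ B)
    (hG : ∀ z ξ, ∃ (G : ℂ → ℂ) (C : ℝ) (L : ℕ), DifferentiableOn ℂ G {ζ | ζ.im ≤ 0} ∧
      (∀ ζ : ℂ, ζ.im ≤ 0 → ‖G ζ‖ ≤ C * (1 + ‖ζ‖) ^ L) ∧ ∀ η : ℝ, G η = b z (pt ξ η))
    (ξ : Tang n) (hint : Integrable fun η : ℝ => kernelTest b φ (pt ξ η)) :
    ∫ η : ℝ, kernelTest b φ (pt ξ η) = 0 := by
  have hreg0 : ∀ δ : ℝ, 0 < δ → ∀ ζ : ℂ, ζ.im ≤ 0 → 1 + Complex.I * δ * ζ ≠ 0 := fun δ hδ ζ hζ =>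
    norm_pos_iff.1 (zero_lt_one.trans_le (one_le_norm_one_add_mul_I hζ hδ))
  -- The factor $(1+i\delta\eta)^{-2}$ makes the double integral in $(\eta,z)$ absolutely
  -- convergent. After the exchange, the integral in $\eta$ vanishes for almost every $z$ by
  -- holomorphy; $\delta\to 0$ is taken at the end, by dominated convergence.
  have hker : ∀ δ : ℝ, 0 < δ →
      ∫ η : ℝ, kernelTest b φ (pt ξ η) * ((1 + Complex.I * δ * η) ^ 2)⁻¹ = 0 := by
    intro δ hδ
    let g : ℝ → Amb n → ℂ := fun η z => b z ((2 * Real.pi) • pt ξ η) *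
      Complex.exp (2 * Real.pi * Complex.I * (inner ℝ z (pt ξ η) : ℝ)) * φ z *
        ((1 + Complex.I * δ * η) ^ 2)⁻¹
    have hgc : Continuous fun u : ℝ × Amb n => g u.1 u.2 := by
      have h1 : Continuous fun u : ℝ × Amb n => b u.2 ((2 * Real.pi) • pt ξ u.1) :=
        hb.comp (f := fun u : ℝ × Amb n => (u.2, (2 * Real.pi) • pt ξ u.1)) (by fun_prop)
      have h2 : Continuous fun u : ℝ × Amb n => ((1 + Complex.I * δ * u.1) ^ 2)⁻¹ :=
        Continuous.inv₀ (by fun_prop) fun u => pow_ne_zero _ (hreg0 δ hδ _ (by simp))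
      have h3 : Continuous fun u : ℝ × Amb n =>
          Complex.exp (2 * Real.pi * Complex.I * (inner ℝ u.2 (pt ξ u.1) : ℝ)) := by fun_prop
      exact ((h1.mul h3).mul (hφ.comp continuous_snd)).mul h2
    have hgi : Integrable (fun u : ℝ × Amb n => g u.1 u.2) (volume.prod volume) := by
      have h1 : Integrable fun η : ℝ => B * (1 + (δ * η) ^ 2)⁻¹ :=
        (integrable_inv_one_add_sq.comp_mul_left' hδ.ne').const_mul B
      have h2 : Integrable fun z => ‖φ z‖ := (hφ.integrable_of_hasCompactSupport hφc).norm
      refine (h1.mul_prod h2).mono' hgc.aestronglyMeasurable (Eventually.of_forall fun u => ?_)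
      simp only [g]
      by_cases hu : φ u.2 = 0
      · simp [hu]
      have h3 : ‖Complex.exp (2 * Real.pi * Complex.I * (inner ℝ u.2 (pt ξ u.1) : ℝ))‖ = 1 := by
        rw [Complex.norm_exp]; simp
      have h4 : ‖((1 + Complex.I * δ * u.1) ^ 2)⁻¹‖ ≤ (1 + (δ * u.1) ^ 2)⁻¹ := by
        rw [norm_inv, norm_pow]
        refine inv_anti₀ (by positivity) ?_
        have := one_add_sq_le_norm_one_add_mul_I (ζ := (u.1 : ℂ)) (by simp) hδ
        rw [Complex.norm_real, Real.norm_eq_abs, sq_abs] at this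
        rwa [mul_pow]
      rw [norm_mul, norm_mul, norm_mul, h3, mul_one]
      calc _ ≤ B * ‖φ u.2‖ * (1 + (δ * u.1) ^ 2)⁻¹ := by
            have hB0 := (norm_nonneg _).trans (hB _ hu 0)
            gcongr
            exact hB _ hu _
        _ = _ := by ring
    have h1 : ∀ η : ℝ, kernelTest b φ (pt ξ η) * ((1 + Complex.I * δ * η) ^ 2)⁻¹ = ∫ z, g η z :=
      fun η => (integral_mul_const _ _).symm
    simp_rw [h1]
    rw [integral_integral_swap hgi]
    refine integral_eq_zero_of_ae ?_
    filter_upwards [hgi.prod_left_ae] with z hz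
    by_cases hφz : φ z = 0
    · simp [g, hφz]
    obtain ⟨G, C, L, hGd, hGb, hGe⟩ := hG z ((2 * Real.pi) • ξ)
    let f : ℂ → ℂ := fun ζ => G (2 * Real.pi * ζ) *
      Complex.exp (2 * Real.pi * Complex.I * ((inner ℝ z.fst ξ : ℝ) + z.snd * ζ)) * φ z *
        ((1 + Complex.I * δ * ζ) ^ 2)⁻¹
    have him : ∀ ζ : ℂ, ζ.im ≤ 0 → (2 * Real.pi * ζ).im ≤ 0 := fun ζ hζ => by
      simpa using mul_nonpos_of_nonneg_of_nonpos Real.two_pi_pos.le hζ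
    have hfg : ∀ η : ℝ, f η = g η z := fun η => by
      simp only [f, g, smul_pt, inner_pt, ← hGe]
      push_cast
      rfl
    have hfi : Integrable fun η : ℝ => f η := by
      simp only [hfg]; exact hz
    have := integral_eq_zero_of_lowerHalfPlane (f := f)
      (C := |C| * (1 + 2 * Real.pi) ^ L * ‖φ z‖) (M := L) ?_ (fun ζ hζ => ?_) hfi
    · simpa only [hfg, Pi.zero_apply] using this
    · refine ((DifferentiableOn.mul ?_ (by fun_prop)).mul (by fun_prop)).mul
        (DifferentiableOn.inv (by fun_prop) fun ζ hζ => pow_ne_zero _ (hreg0 δ hδ ζ hζ))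
      exact hGd.comp (t := {ζ | ζ.im ≤ 0}) (by fun_prop) fun ζ hζ => him ζ hζ
    · have h3 : ‖Complex.exp (2 * Real.pi * Complex.I *
          ((inner ℝ z.fst ξ : ℝ) + z.snd * ζ))‖ ≤ 1 := by
        rw [Complex.norm_exp, Real.exp_le_one_iff]
        -- This is the only use of the side of the boundary: $\rho\le 0$ and
        -- $\operatorname{Im}\zeta\le 0$ make the exponential bounded by $1$.
        have h5 : (2 * Real.pi * Complex.I * ((inner ℝ z.fst ξ : ℝ) + z.snd * ζ)).re =
            -(2 * Real.pi * (z.snd * ζ.im)) := by simp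
        rw [h5, neg_nonpos]
        exact mul_nonneg Real.two_pi_pos.le (mul_nonneg_of_nonpos_of_nonpos (hφs z hφz) hζ)
      have h4 : ‖((1 + Complex.I * δ * ζ) ^ 2)⁻¹‖ ≤ 1 := by
        rw [norm_inv, norm_pow]
        exact inv_le_one_of_one_le₀ (one_le_pow₀ (one_le_norm_one_add_mul_I hζ hδ))
      have h6 : ‖G (2 * Real.pi * ζ)‖ ≤ |C| * (1 + 2 * Real.pi) ^ L * (1 + ‖ζ‖) ^ L := by
        refine (hGb _ (him ζ hζ)).trans ?_
        rw [mul_assoc |C|, ← mul_pow]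
        gcongr
        · exact le_abs_self C
        · rw [norm_mul, norm_mul, Complex.norm_real, Complex.norm_ofNat, Real.norm_of_nonneg
            Real.pi_pos.le]
          nlinarith [norm_nonneg ζ, Real.pi_pos]
      simp only [f, norm_mul]
      calc _ ≤ (|C| * (1 + 2 * Real.pi) ^ L * (1 + ‖ζ‖) ^ L) * 1 * ‖φ z‖ * 1 := by gcongr
        _ = _ := by ring
  have hlim : Tendsto (fun j : ℕ => ∫ η : ℝ, kernelTest b φ (pt ξ η) *
      ((1 + Complex.I * (1 / ((j : ℝ) + 1) : ℝ) * η) ^ 2)⁻¹) atTop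
      (𝓝 (∫ η : ℝ, kernelTest b φ (pt ξ η))) := by
    refine tendsto_integral_of_dominated_convergence (fun η => ‖kernelTest b φ (pt ξ η)‖)
      (fun j => hint.aestronglyMeasurable.mul (Continuous.aestronglyMeasurable
        (Continuous.inv₀ (by fun_prop) fun η => pow_ne_zero _
          (hreg0 _ Nat.one_div_pos_of_nat _ (by simp))))) hint.norm
      (fun j => Eventually.of_forall fun η => ?_) (Eventually.of_forall fun η => ?_)
    · rw [norm_mul, norm_inv, norm_pow]
      exact mul_le_of_le_one_right (norm_nonneg _) (inv_le_one_of_one_le₀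
        (one_le_pow₀ (one_le_norm_one_add_mul_I (by simp) Nat.one_div_pos_of_nat)))
    · have h1 : Tendsto (fun j : ℕ => (((1 / ((j : ℝ) + 1) : ℝ)) : ℂ)) atTop (𝓝 0) := by
        exact_mod_cast (Complex.continuous_ofReal.tendsto 0).comp
          tendsto_one_div_add_atTop_nhds_zero_nat
      have h2 : ContinuousAt (fun δ : ℂ => kernelTest b φ (pt ξ η) *
          ((1 + Complex.I * δ * η) ^ 2)⁻¹) 0 :=
        continuousAt_const.mul (ContinuousAt.inv₀ (by fun_prop) (by simp))
      simpa [Function.comp_def] using h2.tendsto.comp h1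
  refine tendsto_nhds_unique hlim ?_
  simp only [hker _ Nat.one_div_pos_of_nat]
  exact tendsto_const_nhds

end PsiDO

/-! ### The Fourier transform of a boundary distribution -/

namespace PsiDO

variable {n : ℕ}

theorem norm_snd_le (ζ : Amb n) : |ζ.snd| ≤ ‖ζ‖ := by
  refine (abs_le_of_sq_le_sq' ?_ (norm_nonneg _)).2
  rw [WithLp.prod_norm_sq_eq_of_L2, sq_abs, Real.norm_eq_abs, sq_abs]
  nlinarith [sq_nonneg ‖ζ.fst‖]

theorem measurePreserving_pt :
    MeasurePreserving (fun u : Tang n × ℝ => pt u.1 u.2) (volume.prod volume) volume :=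
  WithLp.volume_preserving_toLp (Tang n) ℝ

theorem measurableEmbedding_pt : MeasurableEmbedding (fun u : Tang n × ℝ => pt u.1 u.2) :=
  (MeasurableEquiv.toLp 2 (Tang n × ℝ)).measurableEmbedding

theorem integral_amb {f : Amb n → ℂ} (hf : Integrable f) :
    ∫ w, f w = ∫ ξ : Tang n, ∫ η : ℝ, f (pt ξ η) := by
  rw [← measurePreserving_pt.integral_comp measurableEmbedding_pt,
    integral_prod (fun u : Tang n × ℝ => f (pt u.1 u.2))
      ((measurePreserving_pt.integrable_comp_emb measurableEmbedding_pt).2 hf)]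

theorem lintegral_amb {f : Amb n → ℝ≥0∞} (hf : Measurable f) :
    ∫⁻ w, f w = ∫⁻ ξ : Tang n, ∫⁻ η : ℝ, f (pt ξ η) := by
  rw [← measurePreserving_pt.lintegral_comp hf,
    lintegral_prod (fun u : Tang n × ℝ => f (pt u.1 u.2))
      (hf.comp measurePreserving_pt.measurable).aemeasurable]

theorem exists_norm_schwartz_pt_le (ψ : 𝓢(Amb n, ℂ)) :
    ∃ C : ℝ, ∀ ξ η, ‖ψ (pt ξ η)‖ ≤ C * (1 + η ^ 2)⁻¹ := by
  obtain ⟨C, -, hC⟩ := ψ.decay 0 0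
  obtain ⟨D, -, hD⟩ := ψ.decay 2 0
  refine ⟨C + D, fun ξ η => ?_⟩
  have h1 := hC (pt ξ η)
  have h2 := hD (pt ξ η)
  simp only [norm_iteratedFDeriv_zero, pow_zero, one_mul] at h1 h2
  have h3 : |η| ≤ ‖pt ξ η‖ := norm_snd_le (pt ξ η)
  have h4 : η ^ 2 ≤ ‖pt ξ η‖ ^ 2 := by rw [← sq_abs]; gcongr
  rw [← div_eq_mul_inv, le_div_iff₀ (by positivity)]
  nlinarith [norm_nonneg (ψ (pt ξ η)), mul_le_mul_of_nonneg_right h4 (norm_nonneg (ψ (pt ξ η)))]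

theorem integrable_schwartz_pt (ψ : 𝓢(Amb n, ℂ)) (ξ : Tang n) :
    Integrable fun η : ℝ => ψ (pt ξ η) := by
  obtain ⟨C, hC⟩ := exists_norm_schwartz_pt_le ψ
  exact (integrable_inv_one_add_sq.const_mul C).mono'
    (ψ.continuous.comp (by fun_prop)).aestronglyMeasurable (Eventually.of_forall (hC ξ))

theorem bdryRestrict_fourier_apply (ψ : 𝓢(Amb n, ℂ)) (x : Tang n) :
    bdryRestrict n (𝓕 ψ) x = 𝓕 (fun ξ : Tang n => ∫ η : ℝ, ψ (pt ξ η)) x := by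
  change (𝓕 ψ : 𝓢(Amb n, ℂ)) (pt x 0) = _
  rw [fourier_coe, Real.fourier_eq', Real.fourier_eq', integral_amb]
  · refine integral_congr_ae (Eventually.of_forall fun ξ => ?_)
    simp only [inner_pt, mul_zero, add_zero]
    exact integral_smul (μ := volume)
      (Complex.exp ((-2 * Real.pi * inner ℝ ξ x : ℝ) * Complex.I)) fun η : ℝ => ψ (pt ξ η)
  · refine (ψ.integrable (μ := volume)).bdd_mul (c := 1)
      (Continuous.aestronglyMeasurable (by fun_prop)) (Eventually.of_forall fun z => ?_)
    rw [Complex.norm_exp_ofReal_mul_I]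

/-- Restriction to $\rho=0$ corresponds to integration over $\eta$ on the Fourier side. Fourier
inversion applies since the integrated function is continuous and integrable and its transform is
Schwartz. -/
theorem fourierInv_bdryRestrict_fourier_apply (ψ : 𝓢(Amb n, ℂ)) (ξ : Tang n) :
    (𝓕⁻ (bdryRestrict n (𝓕 ψ)) : 𝓢(Tang n, ℂ)) ξ = ∫ η : ℝ, ψ (pt ξ η) := by
  obtain ⟨C, hC⟩ := exists_norm_schwartz_pt_le ψ
  have hcont : Continuous fun ξ : Tang n => ∫ η : ℝ, ψ (pt ξ η) :=
    continuous_of_dominated (fun ξ => (integrable_schwartz_pt ψ ξ).aestronglyMeasurable)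
      (fun ξ => Eventually.of_forall (hC ξ)) (integrable_inv_one_add_sq.const_mul C)
      (Eventually.of_forall fun η => ψ.continuous.comp (by fun_prop))
  have hint : Integrable fun ξ : Tang n => ∫ η : ℝ, ψ (pt ξ η) :=
    ((measurePreserving_pt.integrable_comp_emb measurableEmbedding_pt).2
      (ψ.integrable (μ := volume))).integral_prod_left
  have heq : 𝓕 (fun ξ : Tang n => ∫ η : ℝ, ψ (pt ξ η)) = bdryRestrict n (𝓕 ψ) :=
    funext fun x => (bdryRestrict_fourier_apply ψ x).symm
  have h := hcont.fourierInv_fourier_eq hint (by rw [heq]; exact SchwartzMap.integrable _)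
  rw [fourierInv_coe, ← heq, h]

/-- The transform of $g_b\otimes\delta$ is $\hat g_b\otimes 1$, with $\hat
g_b=(1+|\xi|^2)^{-\sigma/2}\hat f$ for the $L^2$ function $f$ that represents the Bessel potential
of $g_b$. -/
theorem fourier_tensorDelta_apply {σ : ℝ} {gb : 𝓢'(Tang n, ℂ)}
    {f : Lp ℂ 2 (volume : Measure (Tang n))}
    (h : besselPotential (Tang n) ℂ σ gb = (f : 𝓢'(Tang n, ℂ))) (ψ : 𝓢(Amb n, ℂ)) :
    (𝓕 (tensorDelta gb)) ψ = ∫ ξ, ((1 + ‖ξ‖ ^ 2) ^ (-σ / 2) : ℝ) * (∫ η : ℝ, ψ (pt ξ η)) *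
      (𝓕 f : Lp ℂ 2 (volume : Measure (Tang n))) ξ := by
  have h1 : gb = besselPotential (Tang n) ℂ (-σ)
      ((𝓕⁻ (𝓕 f : Lp ℂ 2 (volume : Measure (Tang n))) : Lp ℂ 2 (volume : Measure (Tang n))) :
        𝓢'(Tang n, ℂ)) := by
    rw [fourierInv_fourier_eq, ← h, besselPotential_besselPotential_apply]
    simp
  rw [TemperedDistribution.fourier_apply]
  change gb (bdryRestrict n (𝓕 ψ)) = _
  rw [h1, besselPotential_neg_fourierInv_apply]
  simp only [fourierInv_bdryRestrict_fourier_apply]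

/-! ### Weighted bounds for boundary data -/

/-- The weights $J=(1+t^2)^{1/2}$ and $W=1+2\pi t$ satisfy $J\le W\le 4\pi J$; the absolute value in
the exponent covers both signs of $\sigma$. The factor $2\pi$ reconciles the frequency variable of
`𝓕` with the covariable of the symbol. -/
theorem rpow_japanese_le (σ t : ℝ) (ht : 0 ≤ t) :
    (1 + t ^ 2) ^ (-σ / 2) ≤ (4 * Real.pi) ^ |σ| * (1 + 2 * Real.pi * t) ^ (-σ) := by
  have hpi := Real.pi_gt_three
  set W := 1 + 2 * Real.pi * t with hW
  have hW1 : 1 ≤ W := by rw [hW]; nlinarith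
  have hJ : (1 + t ^ 2) ^ (-σ / 2) = (Real.sqrt (1 + t ^ 2)) ^ (-σ) := by
    rw [Real.sqrt_eq_rpow, ← Real.rpow_mul (by positivity)]; congr 1; ring
  rw [hJ]
  set J := Real.sqrt (1 + t ^ 2)
  have hJ2 : J ^ 2 = 1 + t ^ 2 := Real.sq_sqrt (by positivity)
  have hJ1 : 1 ≤ J := Real.one_le_sqrt.2 (by nlinarith)
  have htJ : t ≤ J := Real.le_sqrt_of_sq_le (by linarith)
  have hJW : J ≤ W := Real.sqrt_le_iff.2 ⟨by linarith, by
    have : t ≤ 2 * Real.pi * t := by nlinarith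
    nlinarith⟩
  have hWJ : W ≤ 4 * Real.pi * J := by rw [hW]; nlinarith
  rcases le_total 0 σ with hσ | hσ
  · rw [abs_of_nonneg hσ, Real.rpow_neg (by linarith), Real.rpow_neg (by linarith),
      ← div_eq_mul_inv, le_div_iff₀ (by positivity), inv_mul_le_iff₀ (by positivity),
      ← Real.mul_rpow (by linarith) (by positivity)]
    exact Real.rpow_le_rpow (by linarith) (by linarith) hσ
  · calc J ^ (-σ) ≤ W ^ (-σ) := Real.rpow_le_rpow (by linarith) hJW (by linarith)
      _ ≤ _ := le_mul_of_one_le_left (by positivity)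
        (Real.one_le_rpow (by linarith) (abs_nonneg _))

theorem fst_smul_amb (c : ℝ) (w : Amb n) : (c • w).fst = c • w.fst := rfl

theorem tangSize_two_pi_smul (w : Amb n) :
    tangSize ((2 * Real.pi) • w) = 1 + 2 * Real.pi * ‖w.fst‖ := by
  rw [tangSize, fst_smul_amb, norm_smul, Real.norm_of_nonneg Real.two_pi_pos.le]

/-- Since $1+|\zeta|\le 2(1+|\xi|)/d$, the Sobolev weight costs $d^{-s}$. The surplus $M-s\ge 1$
leaves a factor $d$, and the powers of $1+|\xi|$ add up to $s+k-(s+k+\tfrac12)=-\tfrac12$. -/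
theorem weight_le {k s : ℝ} (hs : 0 ≤ s) {M : ℕ} (hM : s + 1 ≤ M) (w : Amb n) :
    (1 + ‖w‖) ^ s * (tangSize ((2 * Real.pi) • w) ^ k * normalDecay ((2 * Real.pi) • w) ^ M) *
        (1 + ‖w.fst‖ ^ 2) ^ (-(s + k + 1 / 2) / 2) ≤
      2 ^ s * (4 * Real.pi) ^ |s + k + 1 / 2| * (tangSize ((2 * Real.pi) • w) ^ (-(1 / 2) : ℝ) *
        normalDecay ((2 * Real.pi) • w)) := by
  have h1 := rpow_japanese_le (s + k + 1 / 2) ‖w.fst‖ (norm_nonneg _)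
  rw [← tangSize_two_pi_smul] at h1
  have hw : 1 + ‖w‖ ≤ 1 + ‖(2 * Real.pi) • w‖ := by
    rw [norm_smul, Real.norm_of_nonneg Real.two_pi_pos.le]
    nlinarith [norm_nonneg w, Real.pi_gt_three]
  generalize (2 * Real.pi) • w = ζ at h1 hw ⊢
  have hWp := tangSize_pos ζ
  have hnp := norm_normalFactor_pos ζ
  have hdp := normalDecay_pos ζ
  have h2 : (1 + ‖w‖) ^ s ≤ 2 ^ s * (tangSize ζ ^ s * normalDecay ζ ^ (-s)) := by
    have h3 : tangSize ζ ^ s * normalDecay ζ ^ (-s) = ‖normalFactor ζ‖ ^ s := by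
      rw [Real.rpow_neg hdp.le, ← Real.inv_rpow hdp.le, ← Real.mul_rpow hWp.le (by positivity),
        normalDecay]
      congr 1
      field_simp
    rw [h3, ← Real.mul_rpow (by norm_num) hnp.le]
    exact Real.rpow_le_rpow (by positivity)
      (hw.trans (one_add_norm_le_two_mul_norm_normalFactor ζ)) hs
  have h4 : normalDecay ζ ^ (-s) * normalDecay ζ ^ M ≤ normalDecay ζ := by
    rw [← Real.rpow_natCast, ← Real.rpow_add hdp]
    calc _ ≤ normalDecay ζ ^ (1 : ℝ) :=
          Real.rpow_le_rpow_of_exponent_ge hdp (normalDecay_le_one ζ) (by linarith)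
      _ = _ := Real.rpow_one _
  have h5 : tangSize ζ ^ s * tangSize ζ ^ k * tangSize ζ ^ (-(s + k + 1 / 2)) =
      tangSize ζ ^ (-(1 / 2) : ℝ) := by
    rw [← Real.rpow_add hWp, ← Real.rpow_add hWp]; congr 1; ring
  calc _ ≤ 2 ^ s * (tangSize ζ ^ s * normalDecay ζ ^ (-s)) *
        (tangSize ζ ^ k * normalDecay ζ ^ M) *
        ((4 * Real.pi) ^ |s + k + 1 / 2| * tangSize ζ ^ (-(s + k + 1 / 2))) := by gcongr
    _ = 2 ^ s * (4 * Real.pi) ^ |s + k + 1 / 2| *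
        (tangSize ζ ^ s * tangSize ζ ^ k * tangSize ζ ^ (-(s + k + 1 / 2)) *
          (normalDecay ζ ^ (-s) * normalDecay ζ ^ M)) := by ring
    _ ≤ _ := by
      rw [h5]
      gcongr

theorem normalDecay_sq_pt (ξ : Tang n) (η : ℝ) :
    normalDecay ((2 * Real.pi) • pt ξ η) ^ 2 =
      (1 + (2 * Real.pi / (1 + 2 * Real.pi * ‖ξ‖) * η) ^ 2)⁻¹ := by
  have h : 0 < 1 + 2 * Real.pi * ‖ξ‖ := by positivity
  rw [normalDecay, div_pow, norm_normalFactor_sq, tangSize_two_pi_smul]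
  change _ / ((2 * Real.pi * η) ^ 2 + _) = _
  change (1 + 2 * Real.pi * ‖ξ‖) ^ 2 / (_ + (1 + 2 * Real.pi * ‖ξ‖) ^ 2) = _
  field_simp
  ring

theorem integrable_normalDecay_sq_pt (ξ : Tang n) :
    Integrable fun η : ℝ => normalDecay ((2 * Real.pi) • pt ξ η) ^ 2 := by
  have h : 2 * Real.pi / (1 + 2 * Real.pi * ‖ξ‖) ≠ 0 := by positivity
  simp only [normalDecay_sq_pt]
  exact integrable_inv_one_add_sq.comp_mul_left' h

/-- By scaling, $\int d^2\,d\eta$ is half of $1+2\pi|\xi|$, which the factor $(1+2\pi|\xi|)^{-1}$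
compensates. This gain of one power in the square is the half derivative of the trace. -/
theorem lintegral_normalDecay_sq_pt (ξ : Tang n) :
    ∫⁻ η : ℝ, ENNReal.ofReal (tangSize ((2 * Real.pi) • pt ξ η) ^ (-(1 / 2) : ℝ) *
      normalDecay ((2 * Real.pi) • pt ξ η)) ^ 2 ≤ 1 := by
  have h : 0 < 1 + 2 * Real.pi * ‖ξ‖ := by positivity
  have h1 : ∀ η : ℝ, ENNReal.ofReal (tangSize ((2 * Real.pi) • pt ξ η) ^ (-(1 / 2) : ℝ) *
      normalDecay ((2 * Real.pi) • pt ξ η)) ^ 2 = ENNReal.ofReal ((1 + 2 * Real.pi * ‖ξ‖)⁻¹ *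
        normalDecay ((2 * Real.pi) • pt ξ η) ^ 2) := fun η => by
    rw [← ENNReal.ofReal_pow (mul_nonneg (Real.rpow_nonneg (tangSize_pos _).le _)
      (normalDecay_nonneg _)), mul_pow, ← Real.rpow_natCast, ← Real.rpow_mul (tangSize_pos _).le,
      tangSize_two_pi_smul]
    norm_num [Real.rpow_neg_one]
  simp_rw [h1]
  rw [← ofReal_integral_eq_lintegral_ofReal ((integrable_normalDecay_sq_pt ξ).const_mul _)
    (Eventually.of_forall fun η => by positivity), ENNReal.ofReal_le_one, integral_const_mul]
  simp only [normalDecay_sq_pt]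
  rw [Measure.integral_comp_mul_left (fun x : ℝ => (1 + x ^ 2)⁻¹), integral_univ_inv_one_add_sq,
    abs_of_pos (by positivity), smul_eq_mul]
  field_simp
  norm_num

/-- The density depends on $\xi$ alone, so the $\eta$-integral can be carried out first, uniformly
in $\xi$. -/
theorem exists_lintegral_weight_le (k : ℝ) {s : ℝ} (hs : 0 ≤ s) {M : ℕ} (hM : s + 1 ≤ M) :
    ∃ D : ℝ≥0, ∀ h : Tang n → ℂ, Measurable h →
      ∫⁻ w : Amb n, (ENNReal.ofReal ((1 + ‖w‖) ^ s * (tangSize ((2 * Real.pi) • w) ^ k *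
        normalDecay ((2 * Real.pi) • w) ^ M)) *
        ‖((1 + ‖w.fst‖ ^ 2) ^ (-(s + k + 1 / 2) / 2) : ℝ) * h w.fst‖ₑ) ^ 2 ≤
      D ^ 2 * ∫⁻ ξ, ‖h ξ‖ₑ ^ 2 := by
  refine ⟨Real.toNNReal (2 ^ s * (4 * Real.pi) ^ |s + k + 1 / 2|), fun h hh => ?_⟩
  set D : ℝ := 2 ^ s * (4 * Real.pi) ^ |s + k + 1 / 2|
  have hD : 0 ≤ D := by positivity
  let g : Amb n → ℝ≥0∞ := fun w => ENNReal.ofReal (tangSize ((2 * Real.pi) • w) ^ (-(1 / 2) : ℝ) *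
      normalDecay ((2 * Real.pi) • w))
  have hg : Measurable g := by
    have h1 : Measurable fun w : Amb n => tangSize ((2 * Real.pi) • w) :=
      Continuous.measurable (by fun_prop)
    have h2 : Measurable fun w : Amb n => normalDecay ((2 * Real.pi) • w) :=
      Continuous.measurable (by fun_prop)
    fun_prop
  have hh' : Measurable fun w : Amb n => ‖h w.fst‖ₑ :=
    (hh.comp (Continuous.measurable (by fun_prop))).enorm
  calc _ ≤ ∫⁻ w : Amb n, (ENNReal.ofReal D * (g w * ‖h w.fst‖ₑ)) ^ 2 := by
        refine lintegral_mono fun w => ?_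
        refine pow_le_pow_left₀ zero_le ?_ 2
        rw [enorm_mul, ← mul_assoc (ENNReal.ofReal _), ← mul_assoc (ENNReal.ofReal _),
          ← ofReal_norm, Complex.norm_real,
          Real.norm_of_nonneg (by positivity), ← ENNReal.ofReal_mul (mul_nonneg (by positivity)
            (mul_nonneg (Real.rpow_nonneg (tangSize_pos _).le _)
              (pow_nonneg (normalDecay_nonneg _) _))), ← ENNReal.ofReal_mul hD]
        exact mul_le_mul' (ENNReal.ofReal_le_ofReal (weight_le hs hM w)) le_rfl
    _ = ENNReal.ofReal D ^ 2 * ∫⁻ w : Amb n, g w ^ 2 * ‖h w.fst‖ₑ ^ 2 := by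
        rw [← lintegral_const_mul _ (by fun_prop)]
        simp_rw [mul_pow]
    _ = ENNReal.ofReal D ^ 2 * ∫⁻ ξ, (∫⁻ η : ℝ, g (pt ξ η) ^ 2) * ‖h ξ‖ₑ ^ 2 := by
        rw [lintegral_amb (by fun_prop)]
        congr 1
        refine lintegral_congr fun ξ => ?_
        exact lintegral_mul_const (μ := volume) (f := fun η : ℝ => g (pt ξ η) ^ 2)
          (‖h ξ‖ₑ ^ 2) ((hg.comp (f := fun η : ℝ => pt ξ η)
          (Continuous.measurable (by fun_prop))).pow_const 2)
    _ ≤ _ := by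
        gcongr with ξ
        · exact le_rfl
        · exact mul_le_of_le_one_left zero_le (lintegral_normalDecay_sq_pt ξ)

end PsiDO

/-! ### The Sobolev estimate in the lower half-space -/

theorem IsSmoothFamily.of_support {X Y : Type} [NormedAddCommGroup X] [NormedSpace ℝ X]
    {K : Set X} {μ : Y → ℝ} {p : X → Y → ℂ} (hK : IsClosed K) (hμ : ∀ y, 0 ≤ μ y)
    (hp : IsSmoothFamily K μ p) (hpK : ∀ z ∉ K, ∀ y, p z y = 0) :
    IsSmoothFamily Set.univ μ p := by
  refine ⟨hp.contDiff, fun i => ?_⟩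
  obtain ⟨C, hC0, hC⟩ := hp.bound i
  refine ⟨C, hC0, fun z _ y => ?_⟩
  by_cases hz : z ∈ K
  · exact hC z hz y
  · rw [iteratedFDeriv_eq_zero_of_notMem hK (fun z hz => hpK z hz y) i hz, norm_zero]
    exact mul_nonneg hC0 (hμ y)

namespace PsiDO

variable {n N : ℕ}

theorem continuous_kernelTest_integrand {b : Amb n → Amb n → ℂ}
    (hb : Continuous fun u : Amb n × Amb n => b u.1 u.2) {φ : Amb n → ℂ} (hφ : Continuous φ) :
    Continuous fun u : Amb n × Amb n => b u.2 ((2 * Real.pi) • u.1) *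
      Complex.exp (2 * Real.pi * Complex.I * (inner ℝ u.2 u.1 : ℝ)) * φ u.2 := by
  have h1 : Continuous fun u : Amb n × Amb n => b u.2 ((2 * Real.pi) • u.1) :=
    hb.comp (f := fun u : Amb n × Amb n => (u.2, (2 * Real.pi) • u.1)) (by fun_prop)
  fun_prop

theorem stronglyMeasurable_kernelTest {b : Amb n → Amb n → ℂ}
    (hb : Continuous fun u : Amb n × Amb n => b u.1 u.2) {φ : Amb n → ℂ} (hφ : Continuous φ) :
    StronglyMeasurable (kernelTest b φ) :=
  (continuous_kernelTest_integrand hb hφ).stronglyMeasurable.integral_prod_right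

theorem integrable_kernelTest_integrand {b : Amb n → Amb n → ℂ}
    (hb : Continuous fun u : Amb n × Amb n => b u.1 u.2) {φ : Amb n → ℂ} (hφ : Continuous φ)
    (hφc : HasCompactSupport φ) (w : Amb n) :
    Integrable fun z => b z ((2 * Real.pi) • w) *
      Complex.exp (2 * Real.pi * Complex.I * (inner ℝ z w : ℝ)) * φ z :=
  Continuous.integrable_of_hasCompactSupport
    ((continuous_kernelTest_integrand hb hφ).comp (f := fun z => (w, z)) (by fun_prop))
    hφc.mul_left

theorem kernelTest_sub {b c : Amb n → Amb n → ℂ}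
    (hb : Continuous fun u : Amb n × Amb n => b u.1 u.2)
    (hc : Continuous fun u : Amb n × Amb n => c u.1 u.2) {φ : Amb n → ℂ} (hφ : Continuous φ)
    (hφc : HasCompactSupport φ) (w : Amb n) :
    kernelTest (fun z ζ => b z ζ - c z ζ) φ w = kernelTest b φ w - kernelTest c φ w := by
  simp only [kernelTest]
  rw [← integral_sub (integrable_kernelTest_integrand hb hφ hφc w)
    (integrable_kernelTest_integrand hc hφ hφc w)]
  congr 1; ext z; ring

theorem exists_norm_kernelTest_le {K : Set (Amb n)} {μ : Amb n → ℝ} {b : Amb n → Amb n → ℂ}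
    (hb : IsSmoothFamily K μ b) {φ : Amb n → ℂ} (hφ : Continuous φ)
    (hφc : HasCompactSupport φ) (hφK : ∀ z ∉ K, φ z = 0) :
    ∃ C : ℝ, ∀ w, ‖kernelTest b φ w‖ ≤ C * μ ((2 * Real.pi) • w) := by
  obtain ⟨C, -, hC⟩ := hb.bound 0
  refine ⟨C * ∫ z, ‖φ z‖, fun w => ?_⟩
  calc _ ≤ ∫ z, C * μ ((2 * Real.pi) • w) * ‖φ z‖ := by
        refine norm_integral_le_of_norm_le
          ((hφ.integrable_of_hasCompactSupport hφc).norm.const_mul _)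
          (Eventually.of_forall fun z => ?_)
        by_cases hz : z ∈ K
        · have h1 := hC z hz ((2 * Real.pi) • w)
          rw [norm_iteratedFDeriv_zero] at h1
          have h2 : ‖Complex.exp (2 * Real.pi * Complex.I * (inner ℝ z w : ℝ))‖ = 1 := by
            rw [Complex.norm_exp]; simp
          rw [norm_mul, norm_mul, h2, mul_one]
          gcongr
        · simp [hφK z hz]
    _ = _ := by rw [integral_const_mul]; ring

/-- The modified symbol is not claimed to give Schwartz kernels; two powers of `normalDecay` suffice
for integrability in $\eta$. -/
theorem integrable_kernelTest_pt {k : ℝ} {M : ℕ} (hM : 2 ≤ M) {K : Set (Amb n)}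
    {b : Amb n → Amb n → ℂ} (hbc : Continuous fun u : Amb n × Amb n => b u.1 u.2)
    (hb : IsSmoothFamily K (fun ζ => tangSize ζ ^ k * normalDecay ζ ^ M) b) {φ : Amb n → ℂ}
    (hφ : Continuous φ) (hφc : HasCompactSupport φ) (hφK : ∀ z ∉ K, φ z = 0) (ξ : Tang n) :
    Integrable fun η : ℝ => kernelTest b φ (pt ξ η) := by
  obtain ⟨C, hC⟩ := exists_norm_kernelTest_le hb hφ hφc hφK
  refine ((integrable_normalDecay_sq_pt ξ).const_mul
    (|C| * (1 + 2 * Real.pi * ‖ξ‖) ^ k)).mono' ?_ (Eventually.of_forall fun η => ?_)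
  · exact ((stronglyMeasurable_kernelTest hbc hφ).comp_measurable
      (Continuous.measurable (by fun_prop))).aestronglyMeasurable
  · refine (hC _).trans ?_
    have h1 : tangSize ((2 * Real.pi) • pt ξ η) = 1 + 2 * Real.pi * ‖ξ‖ := tangSize_two_pi_smul _
    have h2 := pow_le_pow_of_le_one (normalDecay_nonneg ((2 * Real.pi) • pt ξ η))
      (normalDecay_le_one _) hM
    have h3 := pow_nonneg (normalDecay_nonneg ((2 * Real.pi) • pt ξ η)) M
    simp only [h1]
    rw [← mul_assoc]
    gcongr
    exact le_abs_self C

/-- On `{ρ < 0}` the operator acts on boundary distributions like the one with the modified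
symbol. -/
theorem integral_kernelTest_eq_modSymbol {k : ℝ} (hk : k ≤ 0) {a : Amb n → Amb n → ℂ}
    (ha : IsSymbol k a) {q : Fin N → Amb n → Tang n → ℂ} {aExt : Amb n → Tang n → ℂ → ℂ}
    (hExt : IsMeromorphicExtension a q aExt) (hq : ∀ i, IsSymbol 1 (q i)) {M : ℕ} (hM : 2 ≤ M)
    {φ : Amb n → ℂ} (hφ : ContDiff ℝ ∞ φ) (hφc : HasCompactSupport φ)
    (hφs : ∀ z, φ z ≠ 0 → z.snd ≤ 0) (ξ : Tang n) :
    ∫ η : ℝ, kernelTest a φ (pt ξ η) = ∫ η : ℝ, kernelTest (modSymbol a q M) φ (pt ξ η) := by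
  have hac : Continuous fun u : Amb n × Amb n => a u.1 u.2 := ha.1.continuous
  have hmc := continuous_modSymbol ha hq M
  have hms := isSmoothFamily_modSymbol hk ha hq M hφc
  have hφK : ∀ z ∉ tsupport φ, φ z = 0 := fun z hz => image_eq_zero_of_notMem_tsupport hz
  obtain ⟨ψ, hψ⟩ := exists_schwartzMap_eq_kernelTest hk ha hφ hφc
  have hai : Integrable fun η : ℝ => kernelTest a φ (pt ξ η) := by
    simpa only [hψ] using integrable_schwartz_pt ψ ξ
  have hmi := integrable_kernelTest_pt hM hmc hms hφ.continuous hφc hφK ξ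
  have hsub : ∀ η : ℝ, kernelTest (fun z ζ => a z ζ - modSymbol a q M z ζ) φ (pt ξ η) =
      kernelTest a φ (pt ξ η) - kernelTest (modSymbol a q M) φ (pt ξ η) := fun η =>
    kernelTest_sub hac hmc hφ.continuous hφc _
  rw [← sub_eq_zero, ← integral_sub hai hmi]
  simp_rw [← hsub]
  obtain ⟨A, hA0, hA⟩ := (ha.isSmoothFamily hφc).bound 0
  obtain ⟨B, hB0, hB⟩ := hms.bound 0
  refine integral_kernelTest_pt_eq_zero (B := A + B) (hac.sub hmc) hφ.continuous hφc hφs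
    (fun z hz ζ => ?_) (fun z ξ => exists_extension hac hExt M z ξ) ξ (by
      simp_rw [hsub]; exact hai.sub hmi)
  have hzK : z ∈ tsupport φ := subset_tsupport φ hz
  have h1 := hA z hzK ζ
  have h2 := hB z hzK ζ
  rw [norm_iteratedFDeriv_zero] at h1 h2
  refine (norm_sub_le _ _).trans (add_le_add (h1.trans ?_) (h2.trans ?_))
  · exact mul_le_of_le_one_right hA0
      (Real.rpow_le_one_of_one_le_of_nonpos (by linarith [norm_nonneg ζ]) hk)
  · refine mul_le_of_le_one_right hB0 (mul_le_one₀
      (Real.rpow_le_one_of_one_le_of_nonpos (one_le_tangSize ζ) hk)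
      (pow_nonneg (normalDecay_nonneg ζ) M) (pow_le_one₀ (normalDecay_nonneg ζ)
        (normalDecay_le_one ζ)))

theorem opApply_tensorDelta {k : ℝ} (hk : k ≤ 0) {a : Amb n → Amb n → ℂ}
    (ha : IsSymbol k a) {φ : Amb n → ℂ} (hφ : ContDiff ℝ ∞ φ) (hφc : HasCompactSupport φ)
    {σ : ℝ} {gb : 𝓢'(Tang n, ℂ)} {f : Lp ℂ 2 (volume : Measure (Tang n))}
    (h : besselPotential (Tang n) ℂ σ gb = (f : 𝓢'(Tang n, ℂ))) :
    opApply a (tensorDelta gb) φ = ∫ ξ, ((1 + ‖ξ‖ ^ 2) ^ (-σ / 2) : ℝ) *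
      (∫ η : ℝ, kernelTest a φ (pt ξ η)) * (𝓕 f : Lp ℂ 2 (volume : Measure (Tang n))) ξ := by
  have hex := exists_schwartzMap_eq_kernelTest hk ha hφ hφc
  rw [opApply, dif_pos hex, fourier_tensorDelta_apply h]
  simp only [hex.choose_spec]

theorem rpow_half_lintegral_fourier (f : Lp ℂ 2 (volume : Measure (Tang n))) :
    (∫⁻ ξ, ‖(𝓕 f : Lp ℂ 2 (volume : Measure (Tang n))) ξ‖ₑ ^ 2) ^ (1 / 2 : ℝ) = ‖f‖ₑ := by
  have h1 : ‖f‖ₑ = ‖(𝓕 f : Lp ℂ 2 (volume : Measure (Tang n)))‖ₑ := by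
    rw [← ofReal_norm, ← ofReal_norm, Lp.norm_fourier_eq]
  rw [h1, Lp.enorm_def, eLpNorm_eq_lintegral_rpow_enorm_toReal (by norm_num) (by norm_num)]
  simp

theorem exists_lowerHalfSobolevNorm_le {k : ℝ} (hk : k ≤ 0) {a : Amb n → Amb n → ℂ}
    (ha : IsSymbol k a) {q : Fin N → Amb n → Tang n → ℂ} {aExt : Amb n → Tang n → ℂ → ℂ}
    (hExt : IsMeromorphicExtension a q aExt) (hq : ∀ i, IsSymbol 1 (q i)) {s : ℝ} (hs : 0 ≤ s)
    {χ : Amb n → ℂ} (hχ : ContDiff ℝ ∞ χ) (hχc : HasCompactSupport χ) :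
    ∃ C : ℝ≥0, ∀ (gb : 𝓢'(Tang n, ℂ)) (f : Lp ℂ 2 (volume : Measure (Tang n))),
      besselPotential (Tang n) ℂ (s + k + 1 / 2) gb = (f : 𝓢'(Tang n, ℂ)) →
      lowerHalfSobolevNorm s (cutoff χ (opApply a (tensorDelta gb))) ≤ C * ‖f‖ₑ := by
  -- Large enough both for the weight estimate ($M\ge s+1$) and for integrability of the kernel in
  -- $\eta$ ($M\ge 2$).
  let M : ℕ := ⌈s⌉₊ + 2
  have hM2 : 2 ≤ M := Nat.le_add_left _ _
  have hMs : s + 1 ≤ M := by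
    have := Nat.le_ceil s
    simp only [M]; push_cast; linarith
  let μ : Amb n → ℝ := fun w =>
    tangSize ((2 * Real.pi) • w) ^ k * normalDecay ((2 * Real.pi) • w) ^ M
  have hμ0 : ∀ w, 0 ≤ μ w := fun w => mul_nonneg (Real.rpow_nonneg (tangSize_pos _).le _)
    (pow_nonneg (normalDecay_nonneg _) _)
  have hμm : Measurable μ := by
    have h1 : Measurable fun w : Amb n => tangSize ((2 * Real.pi) • w) :=
      Continuous.measurable (by fun_prop)
    have h2 : Measurable fun w : Amb n => normalDecay ((2 * Real.pi) • w) :=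
      Continuous.measurable (by fun_prop)
    fun_prop
  have hmc := continuous_modSymbol ha hq M
  let p : Amb n → Amb n → ℂ := fun z w => χ z * modSymbol a q M z ((2 * Real.pi) • w)
  have hpc : Continuous fun u : Amb n × Amb n => p u.1 u.2 :=
    (hχ.continuous.comp continuous_fst).mul
      (hmc.comp (f := fun u : Amb n × Amb n => (u.1, (2 * Real.pi) • u.2)) (by fun_prop))
  have hχK : ∀ z ∉ tsupport χ, χ z = 0 := fun z hz => image_eq_zero_of_notMem_tsupport hz
  have hpK : ∀ z ∉ tsupport χ, ∀ w, p z w = 0 := fun z hz w => by simp [p, hχK z hz]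
  have hps : IsSmoothFamily Set.univ μ p := by
    refine IsSmoothFamily.of_support (isClosed_tsupport χ) hμ0 ?_ hpK
    have h1 := (IsSmoothFamily.of_left (Y := Amb n) hχc hχ).mul (fun _ => zero_le_one)
      ((isSmoothFamily_modSymbol hk ha hq M hχc).comp_right fun w : Amb n => (2 * Real.pi) • w)
    simpa only [one_mul] using h1
  obtain ⟨C, hC⟩ := exists_sobolevNorm_superposition_le hχc hpc hps hμm hμ0 hpK hs
  obtain ⟨D, hD⟩ := exists_lintegral_weight_le (n := n) k hs hMs
  refine ⟨C * D, fun gb f hf => ?_⟩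
  let h : Tang n → ℂ := (𝓕 f : Lp ℂ 2 (volume : Measure (Tang n)))
  have hh : StronglyMeasurable h := Lp.stronglyMeasurable _
  have hhn : (∫⁻ ξ, ‖h ξ‖ₑ ^ 2) ^ (1 / 2 : ℝ) = ‖f‖ₑ := rpow_half_lintegral_fourier f
  let v : Amb n → ℂ := fun w =>
    ((1 + ‖w.fst‖ ^ 2) ^ (-(s + k + 1 / 2) / 2) : ℝ) * h w.fst
  have hfst : Continuous fun w : Amb n => w.fst := by fun_prop
  have hv : StronglyMeasurable v := by
    refine StronglyMeasurable.mul (Continuous.stronglyMeasurable ?_)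
      (hh.comp_measurable hfst.measurable)
    exact Complex.continuous_ofReal.comp (Continuous.rpow_const (by fun_prop)
      fun w => Or.inl (by positivity))
  have hI : (∫⁻ w, (ENNReal.ofReal ((1 + ‖w‖) ^ s * μ w) * ‖v w‖ₑ) ^ 2) ^ (1 / 2 : ℝ) ≤
      D * ‖f‖ₑ := by
    refine (ENNReal.rpow_le_rpow (hD h hh.measurable) (by norm_num)).trans_eq ?_
    rw [ENNReal.mul_rpow_of_nonneg _ _ (by norm_num), hhn, ← ENNReal.rpow_natCast,
      ← ENNReal.rpow_mul]
    norm_num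
  -- The bound just proved also yields finiteness, because `f` is in $L^2$ and exponent $1/2$
  -- preserves infinity.
  have hfin : ∫⁻ w, (ENNReal.ofReal ((1 + ‖w‖) ^ s * μ w) * ‖v w‖ₑ) ^ 2 ≠ ⊤ := fun htop => by
    rw [htop, ENNReal.top_rpow_of_pos (by norm_num), top_le_iff] at hI
    exact ENNReal.mul_ne_top ENNReal.coe_ne_top enorm_ne_top hI
  obtain ⟨F, hFn, hF⟩ := hC v hv hfin
  -- The superposition `F` lives on the whole space. It competes in the infimum because replacing
  -- the symbol does not change the pairing with test functions supported in $\rho<0$.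
  refine (iInf₂_le F fun φ hφc hφs => ?_).trans (hFn.trans ?_)
  · obtain ⟨hi, he⟩ := hF φ
    have hker : ∀ w, ∫ z, p z w * Complex.exp (2 * Real.pi * Complex.I * (inner ℝ z w : ℝ)) * φ z =
        kernelTest (modSymbol a q M) (fun z => χ z * φ z) w := fun w => by
      simp only [kernelTest, p]
      congr 1; ext z; ring
    simp only [hker] at hi he
    have hΦ : ContDiff ℝ ∞ fun z => χ z * φ z := hχ.mul φ.smooth'
    rw [he, integral_amb hi, cutoff, opApply_tensorDelta hk ha hΦ hχc.mul_right hf]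
    refine integral_congr_ae (Eventually.of_forall fun ξ => ?_)
    have hs' : ∀ z, χ z * φ z ≠ 0 → z.snd ≤ 0 := fun z hz =>
      le_of_lt (hφs (subset_tsupport _ (right_ne_zero_of_mul hz)))
    simp only
    rw [integral_kernelTest_eq_modSymbol hk ha hExt hq hM2 hΦ hχc.mul_right hs' ξ]
    refine (integral_const_mul (((1 + ‖ξ‖ ^ 2) ^ (-(s + k + 1 / 2) / 2) : ℝ) * h ξ) _).trans ?_
    simp only [h]
    ring
  · rw [ENNReal.coe_mul, mul_assoc]
    gcongr

end PsiDO

theorem mainTheorem1 (n : ℕ) (k : ℝ) (hk : k ≤ -1)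
    -- the symbol of `A`, of order `k`
    (a : PsiDO.Amb n → PsiDO.Amb n → ℂ) (ha : PsiDO.IsSymbol k a)
    -- meromorphic in `η`, with poles `q i`
    (N : ℕ) (q : Fin N → PsiDO.Amb n → PsiDO.Tang n → ℂ)
    (aExt : PsiDO.Amb n → PsiDO.Tang n → ℂ → ℂ)
    (hExt : PsiDO.IsMeromorphicExtension a q aExt)
    (hq : ∀ i, PsiDO.IsSymbol 1 (q i))
    -- the residues are symbols of order `k + 1`
    (r : Fin N → PsiDO.Amb n → PsiDO.Tang n → ℂ)
    (hres : ∀ i z ξ, PsiDO.HasResidueAt (aExt z ξ) (q i z ξ) (r i z ξ))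
    (hr : ∀ i, PsiDO.IsTangentialSymbol (k + 1) (r i))
    -- the imaginary parts of the poles are elliptic
    (hell : ∀ i, PsiDO.IsEllipticOne (fun z ξ => (q i z ξ).im)) :
    ∀ s : ℝ, 0 ≤ s →
    ∀ χ : PsiDO.Amb n → ℂ, ContDiff ℝ ∞ χ → HasCompactSupport χ →
    ∃ C : ℝ≥0, ∀ gb : 𝓢'(PsiDO.Tang n, ℂ), MemSobolev (s + k + 1 / 2) 2 gb →
      PsiDO.lowerHalfSobolevNorm s
          (PsiDO.cutoff χ (PsiDO.opApply a (PsiDO.tensorDelta gb)))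
        ≤ C * PsiDO.sobolevNorm (s + k + 1 / 2) gb := by
  intro s hs χ hχ hχc
  obtain ⟨C, hC⟩ := PsiDO.exists_lowerHalfSobolevNorm_le (by linarith) ha hExt hq hs hχ hχc
  -- A nonzero finite constant can be moved inside the infimum defining the norm of `gb`, even where
  -- that infimum runs over an empty set and equals $\infty$; `C` itself might be zero.
  refine ⟨C + 1, fun gb _ => ?_⟩
  have h0 : ((C + 1 : ℝ≥0) : ℝ≥0∞) ≠ 0 := by simp
  rw [PsiDO.sobolevNorm, ENNReal.mul_iInf_of_ne h0 ENNReal.coe_ne_top]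
  refine le_iInf fun f => ?_
  rw [ENNReal.mul_iInf_of_ne h0 ENNReal.coe_ne_top]
  refine le_iInf fun hf => (hC gb f hf).trans ?_
  gcongr
  exact le_self_add
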